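/- Alphabets are finite. An \emph{oracle npda} is a one-way one-head nondeterministic pushdown automaton with $\lambda$-moves, reading its input between the endmarkers ¢ and $\$$, that has a write-only query tape, a write-only output tape (each step appends at most one symbol to each of them), sets of accepting and of rejecting (together: halting) states, and three further states $q_{query},q_{yes},q_{no}$: whenever it is in $q_{query}$ with the string $s$ on the query tape, the next state is $q_{yes}$ if $s$ is in the oracle language $A$ and $q_{no}$ otherwise, and the query tape becomes blank. Every such machine is required to satisfy the termination condition: there are $a,b\in\mathbb{N}$ such that, whatever the oracle is, on every input of length $n$ all computation paths reach a halting state within $an+b$ steps. With oracle $A$ the machine recognizes the set of inputs that have an accepting computation path, and it computes the multi-valued partial function that maps $x$ to the set of all strings that are on the output tape at the end of an accepting computation path on $x$. For a family $\mathcal{C}$ of languages, let $\mathrm{CFL}_T(\mathcal{C})$ be the family of languages recognized by oracle npda's (without output tape) with an oracle from $\mathcal{C}$, and let $\mathrm{CFLMV}_T(\mathcal{C})$ be the class of multi-valued partial functions computed by oracle npda's with an oracle from $\mathcal{C}$. Let $\Sigma^{\mathrm{CFL}}_1$ be the family of context-free languages and, for $k\ge 1$, let $\Pi^{\mathrm{CFL}}_k$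 be the family of the complements of the languages in $\Sigma^{\mathrm{CFL}}_k$ and $\Sigma^{\mathrm{CFL}}_{k+1}=\mathrm{CFL}_T(\Pi^{\mathrm{CFL}}_k)$. For $k\ge 2$, let $\Sigma^{\mathrm{CFL}}_k\mathrm{SV}_t$ be the class of those functions $f:\Sigma^*\to\mathcal{P}(\Gamma^*)$ in $\mathrm{CFLMV}_T(\Pi^{\mathrm{CFL}}_{k-1})$ (for some alphabets $\Sigma,\Gamma$) that are single-valued and total, i.e. $|f(x)|=1$ for all $x\in\Sigma^*$. For strings $x\in\Sigma^*$ and $y\in\Gamma^*$, let $\left[\begin{smallmatrix}x\\ y\end{smallmatrix}\right]$ be the string of length $\max\{|x|,|y|\}$ over pairs of symbols whose upper track is $x$ and whose lower track is $y$, the shorter of the two being padded at its right end with a new symbol $\#$. For a class $\mathcal{F}$ of functions, $\mathrm{REG}/\!/\mathcal{F}$ is the family of all languages $L$ for which there are a regular language $B$ and a function $h\in\mathcal{F}$ with $L=\{x\mid \exists\, y\in h(x):\ \left[\begin{smallmatrix}x\\ y\end{smallmatrix}\right]\in B\}$. Then, for every $k\ge 3$, \[ \Sigma^{\mathrm{CFL}}_k\cap\Pi^{\mathrm{CFL}}_k=\mathrm{REG}/\!/\Sigma^{\mathrm{CFL}}_k\mathrm{SV}_t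 . \] -/

import Mathlib

/-- Symbols on a read-only input tape over the alphabet `α`: the left endmarker, the letters
of `α`, the right endmarker. -/
inductive TapeSym (α : Type) : Type
  | left : TapeSym α
  | letter : α → TapeSym α
  | right : TapeSym α

/-- The input tape content `¢ x $`. -/
def inputTape {α : Type} (x : List α) : List (TapeSym α) :=
  TapeSym.left :: (x.map TapeSym.letter ++ [TapeSym.right])

/-- A one-way nondeterministic pushdown automaton with input alphabet `α`, a write-only query
tape over `Ω` and a write-only output tape over `Γ`.  A transition depends on the inner state,
on the scanned input symbol (`none` for a `λ`-move) and on the topmost stack symbol; it gives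
the next state, the word that replaces the topmost stack symbol, and at most one symbol to be
appended to the query tape and to the output tape.  Values of `δ` at halting states and at the
query state are never used. -/
structure OracleNPDA (α Ω Γ : Type) where
  State : Type
  Stack : Type
  finite_state : Finite State
  finite_stack : Finite Stack
  δ : State → Option (TapeSym α) → Stack → Set (State × List Stack × Option Ω × Option Γ)
  finite_δ : ∀ q s a, (δ q s a).Finite
  start : State
  bottom : Stack
  acc : Set State
  rej : Set State
  acc_rej_disjoint : Disjoint acc rej
  query : State
  yes : State
  no : State
  query_not_acc : query ∉ acc
  query_not_rej : query ∉ rej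
  query_ne_yes : query ≠ yes
  query_ne_no : query ≠ no
  yes_ne_no : yes ≠ no

namespace OracleNPDA

variable {α Ω Γ : Type}

/-- A configuration: inner state, unread part of the input tape, stack (topmost symbol first),
contents of the query tape and of the output tape. -/
structure Cfg (M : OracleNPDA α Ω Γ) where
  state : M.State
  input : List (TapeSym α)
  stack : List M.Stack
  queryTape : List Ω
  output : List Γ

/-- The initial configuration on input `x`. -/
def init (M : OracleNPDA α Ω Γ) (x : List α) : M.Cfg :=
  ⟨M.start, inputTape x, [M.bottom], [], []⟩

/-- Halting states are the accepting and the rejecting ones. -/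
def halt (M : OracleNPDA α Ω Γ) : Set M.State := M.acc ∪ M.rej

/-- One step of `M` with oracle `A`. -/
inductive Step (M : OracleNPDA α Ω Γ) (A : Language Ω) : M.Cfg → M.Cfg → Prop
  | read {q p : M.State} {s : TapeSym α} {w : List (TapeSym α)} {a : M.Stack}
      {u v : List M.Stack} {y : List Ω} {z : List Γ} {b : Option Ω} {c : Option Γ}
      (h_halt : q ∉ M.halt) (h_query : q ≠ M.query) (h : (p, u, b, c) ∈ M.δ q (some s) a) :
      Step M A ⟨q, s :: w, a :: v, y, z⟩ ⟨p, w, u ++ v, y ++ b.toList, z ++ c.toList⟩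
  | silent {q p : M.State} {w : List (TapeSym α)} {a : M.Stack}
      {u v : List M.Stack} {y : List Ω} {z : List Γ} {b : Option Ω} {c : Option Γ}
      (h_halt : q ∉ M.halt) (h_query : q ≠ M.query) (h : (p, u, b, c) ∈ M.δ q none a) :
      Step M A ⟨q, w, a :: v, y, z⟩ ⟨p, w, u ++ v, y ++ b.toList, z ++ c.toList⟩
  | answerYes {w : List (TapeSym α)} {v : List M.Stack} {y : List Ω} {z : List Γ} (h : y ∈ A) :
      Step M A ⟨M.query, w, v, y, z⟩ ⟨M.yes, w, v, [], z⟩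
  | answerNo {w : List (TapeSym α)} {v : List M.Stack} {y : List Ω} {z : List Γ} (h : y ∉ A) :
      Step M A ⟨M.query, w, v, y, z⟩ ⟨M.no, w, v, [], z⟩

/-- `M.Run A t c d`: with oracle `A`, some computation of exactly `t` steps leads from `c`
to `d`. -/
inductive Run (M : OracleNPDA α Ω Γ) (A : Language Ω) : ℕ → M.Cfg → M.Cfg → Prop
  | refl (c : M.Cfg) : Run M A 0 c c
  | tail {t : ℕ} {c d e : M.Cfg} (h : Run M A t c d) (h' : M.Step A d e) : Run M A (t + 1) c e

/-- The termination condition: no matter what oracle is used, all computation paths reach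
halting states within linearly many steps.  (No computation is longer than the bound, and
none is stuck in a configuration that is not halting.) -/
def Terminates (M : OracleNPDA α Ω Γ) : Prop :=
  ∃ a b : ℕ, ∀ (A : Language Ω) (x : List α) (t : ℕ) (c : M.Cfg), M.Run A t (M.init x) c →
    t ≤ a * x.length + b ∧ (c.state ∈ M.halt ∨ ∃ d, M.Step A c d)

/-- The machine never enters the query state, so that it is an npda without oracle. -/
def QueryFree (M : OracleNPDA α Ω Γ) : Prop :=
  M.start ≠ M.query ∧ ∀ q s a, ∀ r ∈ M.δ q s a, r.1 ≠ M.query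

/-- The language recognized by `M` with oracle `A`. -/
def accepts (M : OracleNPDA α Ω Γ) (A : Language Ω) : Language α :=
  {x | ∃ t c, M.Run A t (M.init x) c ∧ c.state ∈ M.acc}

/-- The set of valid outcomes of `M` with oracle `A` on input `x`, that is, the output strings
produced along accepting computation paths. -/
def outcomes (M : OracleNPDA α Ω Γ) (A : Language Ω) (x : List α) : Set (List Γ) :=
  {z | ∃ t c, M.Run A t (M.init x) c ∧ c.state ∈ M.acc ∧ c.output = z}

end OracleNPDA

/-- Language families: for each (finite) alphabet, a set of languages over it. -/
abbrev LangFamily : Type 1 := ∀ α : Type, Set (Language α)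

/-- Classes of multi-valued partial functions `α* → 𝒫(Γ*)`. -/
abbrev FunClass : Type 1 := ∀ α Γ : Type, Set (List α → Set (List Γ))

/-- The family of context-free languages. -/
def CFL : LangFamily := fun _ => {L | L.IsContextFree}

/-- Complements of the languages of a family. -/
def coFamily (C : LangFamily) : LangFamily := fun α => {L | Lᶜ ∈ C α}

/-- `CFL_T(C)`: the languages recognized by oracle npda's (without output tape) that satisfy
the termination condition, with an oracle from `C`. -/
def CFLT (C : LangFamily) : LangFamily := fun α =>
  {L | ∃ (Ω : Type) (_ : Finite Ω) (A : Language Ω), A ∈ C Ω ∧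
    ∃ M : OracleNPDA α Ω Empty, M.Terminates ∧ L = M.accepts A}

/-- `CFLMV_T(C)`: the multi-valued partial functions computed by oracle npda's that satisfy the
termination condition, with an oracle from `C`. -/
def CFLMVT (C : LangFamily) : FunClass := fun α Γ =>
  {f | ∃ (Ω : Type) (_ : Finite Ω) (A : Language Ω), A ∈ C Ω ∧
    ∃ M : OracleNPDA α Ω Γ, M.Terminates ∧ ∀ x, f x = M.outcomes A x}

/-- `CFLMV`: the multi-valued partial functions computed by npda's (without oracle) that
satisfy the termination condition. The oracle `0` is the empty language; it is never asked. -/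
def CFLMV : FunClass := fun α Γ =>
  {f | ∃ M : OracleNPDA α Empty Γ, M.QueryFree ∧ M.Terminates ∧ ∀ x, f x = M.outcomes 0 x}

/-- The classes `Σ_k^CFL`, `k ≥ 1`; there is no level `0`. -/
def SigmaCFL : ℕ → LangFamily
  | 0 => fun _ => ∅
  | 1 => CFL
  | k + 2 => CFLT (coFamily (SigmaCFL (k + 1)))

/-- The classes `Π_k^CFL`, `k ≥ 1`. -/
def PiCFL (k : ℕ) : LangFamily := coFamily (SigmaCFL k)

/-- The classes `Σ_k^CFL MV`, `k ≥ 1`; there is no level `0`. -/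
def SigmaCFLMV : ℕ → FunClass
  | 0 => fun _ _ => ∅
  | 1 => CFLMV
  | k + 2 => CFLMVT (PiCFL (k + 1))

/-- The classes `Σ_k^CFL SV` of the single-valued (partial) functions. -/
def SigmaCFLSV (k : ℕ) : FunClass := fun α Γ =>
  {f | f ∈ SigmaCFLMV k α Γ ∧ ∀ x, (f x).Subsingleton}

/-- The classes `Σ_k^CFL SV_t` of the single-valued total functions. -/
def SigmaCFLSVt (k : ℕ) : FunClass := fun α Γ =>
  {f | f ∈ SigmaCFLSV k α Γ ∧ ∀ x, (f x).Nonempty}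

/-- The two-track string of `x` (upper track) and `y` (lower track), where the shorter one is
padded at its end with the new symbol `#`, here `none`. -/
def track {α Γ : Type} (x : List α) (y : List Γ) : List (Option α × Option Γ) :=
  List.zipWithAll Prod.mk x y

/-- `REG // F`. -/
def RegAdvice (F : FunClass) : LangFamily := fun α =>
  {L | ∃ (Γ : Type) (_ : Finite Γ) (B : Language (Option α × Option Γ))
    (h : List α → Set (List Γ)), B.IsRegular ∧ h ∈ F α Γ ∧ L = {x | ∃ y ∈ h x, track x y ∈ B}}

/-
(⊆) For `L ∈ Σₖ ∩ Πₖ`, run a machine for `L` or a machine for `Lᶜ`, chosen nondeterministically,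
and output which of the two accepts; exactly one does, and the regular language only has to look at
the first letter of the lower track. The two oracles are merged into one by tagging the queries.

(⊇) If `h` is single-valued and total, then the complement of `{x | ∃ y ∈ h x, [x, y] ∈ B}` is the
same set for `Bᶜ`, so it suffices to recognize this set. Let `M` compute `h` with an oracle `A`, and
let `M'` recognize `Aᶜ` with an oracle `A'`. A certificate for `x` consists of a transcript of an
accepting run of `M` on `x`, transcripts of accepting runs of `M'` on the queries that `M` was told
are not in `A`, and the two-track word of `x` and the output. The recognizing machine guesses a
certificate while it reads its input, and submits everything as one single query. An invalid
certificate violates one of finitely many conditions, and each violation can be found with the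
oracle `A'`: transcripts are checked by a deterministic pushdown automaton, two words that ought to
agree are compared with a counter at a guessed position, and for an answer that may be wrong the
query is submitted to `A'` if it was asked by `M'`, and given to `M'` as its input if it was asked
by `M` and answered positively. Hence the certificates are the complement of a language in
`CFL_T({A'})`. As `A` belongs to `Π_{k-1}` with `k - 1 ≥ 2`, we can take `A'` in `Π_{k-2}`, and then
the certificates form a language in `Π_{k-1}`.
-/

namespace OracleNPDA

variable {α Ω Γ : Type} {M : OracleNPDA α Ω Γ} {A : Language Ω}

/-- The state in which `M` resumes its work when the oracle answers `b`. -/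
def reply (M : OracleNPDA α Ω Γ) (b : Bool) : M.State :=
  if b then M.yes else M.no

theorem Step.move {q p : M.State} {s : Option (TapeSym α)} {w : List (TapeSym α)} {a : M.Stack}
    {u v : List M.Stack} {y : List Ω} {z : List Γ} {b : Option Ω} {o : Option Γ}
    (h_halt : q ∉ M.halt) (h_query : q ≠ M.query) (h : (p, u, b, o) ∈ M.δ q s a) :
    M.Step A ⟨q, s.toList ++ w, a :: v, y, z⟩ ⟨p, w, u ++ v, y ++ b.toList, z ++ o.toList⟩ := by
  cases s
  exacts [.silent h_halt h_query h, .read h_halt h_query h]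

theorem Step.answer {w : List (TapeSym α)} {v : List M.Stack} {y : List Ω} {z : List Γ} {b : Bool}
    (h : b = true ↔ y ∈ A) : M.Step A ⟨M.query, w, v, y, z⟩ ⟨M.reply b, w, v, [], z⟩ := by
  cases b
  exacts [.answerNo (by simpa using h), .answerYes (by simpa using h)]

@[elab_as_elim]
theorem Step.move_or_answer {motive : ∀ c d : M.Cfg, M.Step A c d → Prop}
    (move : ∀ {q p s w a u v y z b o} (h_halt : q ∉ M.halt) (h_query : q ≠ M.query)
      (h : (p, u, b, o) ∈ M.δ q s a),
      motive ⟨q, s.toList ++ w, a :: v, y, z⟩ ⟨p, w, u ++ v, y ++ b.toList, z ++ o.toList⟩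
        (.move h_halt h_query h))
    (answer : ∀ {w v y z b} (h : b = true ↔ y ∈ A),
      motive ⟨M.query, w, v, y, z⟩ ⟨M.reply b, w, v, [], z⟩ (.answer h))
    {c d : M.Cfg} (h : M.Step A c d) : motive c d h := by
  cases h with
  | read h_halt h_query h => exact move (s := some _) h_halt h_query h
  | silent h_halt h_query h => exact move (s := none) h_halt h_query h
  | answerYes h => exact answer (b := true) (by simpa using h)
  | answerNo h => exact answer (b := false) (by simpa using h)

theorem Run.single {c d : M.Cfg} (h : M.Step A c d) : M.Run A 1 c d :=
  (Run.refl c).tail h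

theorem Run.trans {s t : ℕ} {c d e : M.Cfg} (h : M.Run A s c d) (h' : M.Run A t d e) :
    M.Run A (s + t) c e := by
  induction h' with
  | refl => exact h
  | tail _ hs ih => exact (ih h).tail hs

theorem Run.cases_head {t : ℕ} {c e : M.Cfg} (h : M.Run A t c e) :
    (t = 0 ∧ c = e) ∨ ∃ s d, t = s + 1 ∧ M.Step A c d ∧ M.Run A s d e := by
  induction h with
  | refl => exact .inl ⟨rfl, rfl⟩
  | tail h hs ih =>
    obtain ⟨rfl, rfl⟩ | ⟨s, d, rfl, h_first, h_rest⟩ := ih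
    · exact .inr ⟨0, _, rfl, hs, .refl _⟩
    · exact .inr ⟨s + 1, d, rfl, h_first, h_rest.tail hs⟩

theorem Run.invariant {I : ℕ → M.Cfg → Prop}
    (h_step : ∀ {t c d}, I t c → M.Step A c d → I (t + 1) d) {t : ℕ} {c d : M.Cfg}
    (h : M.Run A t c d) (h_init : I 0 c) : I t d := by
  induction h with
  | refl => exact h_init
  | tail _ hs ih => exact h_step (ih h_init) hs

theorem Run.add_potential_le {φ : M.Cfg → ℕ} (h_step : ∀ {c d}, M.Step A c d → φ d < φ c) {t : ℕ}
    {c d : M.Cfg} (h : M.Run A t c d) : t + φ d ≤ φ c :=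
  h.invariant (I := fun t d => t + φ d ≤ φ c) (fun ih hs => by have := h_step hs; omega) (by omega)

end OracleNPDA

/-- The languages over `α` recognized by terminating oracle machines with oracle `A`. -/
def Recog {Ω : Type} (A : Language Ω) (α : Type) : Set (Language α) :=
  {L | ∃ M : OracleNPDA α Ω Empty, M.Terminates ∧ L = M.accepts A}

instance TapeSym.instFinite {α : Type} [Finite α] : Finite (TapeSym α) :=
  Finite.of_injective (β := Option (Option α))
    (fun | .left => none | .right => some none | .letter a => some (some a))
    (by rintro (_ | _ | _) (_ | _ | _) h <;> simp_all)

/-- The inner states of a machine whose proper work is done in the states `Q`: the initial state,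
the states `Q`, the query state, the states after an answer, and the two halting states. -/
inductive Control (Q : Type) : Type
  | start
  | run (q : Q)
  | query
  | answer (b : Bool)
  | accept
  | reject

namespace Control

variable {Q : Type}

instance [Finite Q] : Finite (Control Q) :=
  Finite.of_injective (β := Fin 4 ⊕ Q ⊕ Bool)
    (fun
      | start => .inl 0 | query => .inl 1 | accept => .inl 2 | reject => .inl 3
      | run q => .inr (.inl q) | answer b => .inr (.inr b))
    (by rintro (_ | _ | _ | _ | _ | _) (_ | _ | _ | _ | _ | _) h <;> simp_all)

/-- The states that have transitions of their own. -/
def Active : Control Q → Prop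
  | start | run _ | answer _ => True
  | query | accept | reject => False

end Control

theorem exists_bound_of_finite {ι R : Type*} [Finite ι] {f : ι → Set R} (hf : ∀ i, (f i).Finite)
    (ℓ : R → ℕ) : ∃ n, ∀ i, ∀ r ∈ f i, ℓ r ≤ n := by
  obtain ⟨n, hn⟩ := ((Set.finite_iUnion hf).image ℓ).bddAbove
  exact ⟨n, fun i r hr => hn ⟨r, Set.mem_iUnion.2 ⟨i, hr⟩, rfl⟩⟩

/-- A machine with the inner states `Control Work` that never removes the bottom mark of its stack.
To each `Skeleton` belongs a machine that in addition can reject at any time, so that it is never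
stuck: see `Skeleton.machine`. -/
structure Skeleton (α Ω Γ : Type) where
  Work : Type
  Stack : Type
  finite_work : Finite Work
  finite_stack : Finite Stack
  bottom : Stack
  Trans : Control Work → Option (TapeSym α) → Stack →
    Control Work × List Stack × Option Ω × Option Γ → Prop
  exists_push_bound : ∃ n, ∀ q s a r, Trans q s a r → r.2.1.length ≤ n
  getLast?_push : ∀ {q s r}, Trans q s bottom r → r.2.1.getLast? = some bottom

namespace Skeleton

variable {α Ω Γ : Type} [Finite Ω] [Finite Γ]

theorem finite_trans (S : Skeleton α Ω Γ) (q : Control S.Work) (s : Option (TapeSym α))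
    (a : S.Stack) :
    {r | S.Trans q s a r ∨ s = none ∧ r = (.reject, [a], none, none)}.Finite := by
  have := S.finite_work
  have := S.finite_stack
  obtain ⟨n, hn⟩ := S.exists_push_bound
  have short_pushes : (Set.univ ×ˢ {u | u.length ≤ n} ×ˢ Set.univ :
      Set (Control S.Work × List S.Stack × Option Ω × Option Γ)).Finite :=
    Set.finite_univ.prod ((List.finite_length_le S.Stack n).prod Set.finite_univ)
  refine (short_pushes.union (Set.finite_singleton (.reject, [a], none, none))).subset ?_
  rintro r (hr | ⟨-, rfl⟩)
  · exact .inl ⟨trivial, hn _ _ _ _ hr, trivial⟩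
  · exact .inr rfl

/-- The machine of a skeleton. -/
abbrev machine (S : Skeleton α Ω Γ) : OracleNPDA α Ω Γ where
  State := Control S.Work
  Stack := S.Stack
  finite_state := have := S.finite_work; inferInstance
  finite_stack := S.finite_stack
  δ q s a := {r | S.Trans q s a r ∨ s = none ∧ r = (.reject, [a], none, none)}
  finite_δ := S.finite_trans
  start := .start
  bottom := S.bottom
  acc := {.accept}
  rej := {.reject}
  acc_rej_disjoint := by simp
  query := .query
  yes := .answer true
  no := .answer false
  query_not_acc := by simp
  query_not_rej := by simp
  query_ne_yes := by simp
  query_ne_no := by simp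
  yes_ne_no := by simp

variable {S : Skeleton α Ω Γ} {A : Language Ω}

theorem not_mem_halt_of_active {q : Control S.Work} (hq : q.Active) : q ∉ S.machine.halt := by
  rintro (rfl | rfl) <;> exact hq

theorem ne_query_of_active {q : Control S.Work} (hq : q.Active) : q ≠ S.machine.query := by
  rintro rfl
  exact hq

theorem step_of_trans {q : Control S.Work} {s : Option (TapeSym α)} {w : List (TapeSym α)}
    {a : S.Stack} {v : List S.Stack} {y : List Ω} {z : List Γ}
    {r : Control S.Work × List S.Stack × Option Ω × Option Γ} (h : S.Trans q s a r)
    (hq : q.Active := by trivial) :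
    S.machine.Step A ⟨q, s.toList ++ w, a :: v, y, z⟩
      ⟨r.1, w, r.2.1 ++ v, y ++ r.2.2.1.toList, z ++ r.2.2.2.toList⟩ :=
  .move (not_mem_halt_of_active hq) (ne_query_of_active hq) (.inl h)

theorem step_of_mem_iff {w : List (TapeSym α)} {v : List S.Stack} {y : List Ω} {z : List Γ}
    {b : Bool} (h : b = true ↔ y ∈ A) :
    S.machine.Step A ⟨.query, w, v, y, z⟩ ⟨.answer b, w, v, [], z⟩ := by
  have := OracleNPDA.Step.answer (M := S.machine) (w := w) (v := v) (z := z) h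
  cases b <;> exact this

theorem exists_step_of_query (w : List (TapeSym α)) (v : List S.Stack) (y : List Ω) (z : List Γ) :
    ∃ b, (b = true ↔ y ∈ A) ∧ S.machine.Step A ⟨.query, w, v, y, z⟩ ⟨.answer b, w, v, [], z⟩ := by
  classical
  exact ⟨decide (y ∈ A), by simp, step_of_mem_iff (by simp)⟩

@[elab_as_elim]
theorem step_cases {motive : ∀ c d : S.machine.Cfg, S.machine.Step A c d → Prop}
    (trans : ∀ {q s w a v y z r} (_ : S.Trans q s a r) (hs : S.machine.Step A
      ⟨q, s.toList ++ w, a :: v, y, z⟩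
      ⟨r.1, w, r.2.1 ++ v, y ++ r.2.2.1.toList, z ++ r.2.2.2.toList⟩), motive _ _ hs)
    (escape : ∀ {q w a v y y' z z'} (_ : q.Active)
      (hs : S.machine.Step A ⟨q, w, a :: v, y, z⟩ ⟨.reject, w, a :: v, y', z'⟩), motive _ _ hs)
    (answer : ∀ {w v y z b} (_ : b = true ↔ y ∈ A)
      (hs : S.machine.Step A ⟨.query, w, v, y, z⟩ ⟨.answer b, w, v, [], z⟩), motive _ _ hs)
    {c d : S.machine.Cfg} (h : S.machine.Step A c d) : motive c d h := by
  cases h using OracleNPDA.Step.move_or_answer with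
  | @move q p s w a u v y z b o h_halt h_query h =>
    obtain h | ⟨rfl, h⟩ := h
    · exact trans h _
    · cases h
      have hq : q.Active := by
        cases q
        case query => exact h_query rfl
        case accept => exact h_halt (.inl rfl)
        case reject => exact h_halt (.inr rfl)
        all_goals trivial
      exact escape hq _
  | @answer w v y z b h =>
    have := answer (w := w) (v := v) (z := z) h
    cases b <;> exact this _

theorem getLast?_stack_of_run {t : ℕ} {x : List α} {c : S.machine.Cfg}
    (h : S.machine.Run A t (S.machine.init x) c) : c.stack.getLast? = some S.bottom := by
  refine h.invariant (I := fun _ c => c.stack.getLast? = some S.bottom) (fun hc hs => ?_) rfl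
  cases hs using step_cases with
  | @trans q s w a v y z r h =>
    cases v with
    | nil =>
      obtain rfl : a = S.bottom := by simpa using hc
      simpa using S.getLast?_push h
    | cons a' v => simpa [List.getLast?_append] using hc
  | escape => exact hc
  | answer => exact hc

theorem mem_halt_or_exists_step {t : ℕ} {x : List α} {c : S.machine.Cfg}
    (h : S.machine.Run A t (S.machine.init x) c) :
    c.state ∈ S.machine.halt ∨ ∃ d, S.machine.Step A c d := by
  have h_stack := getLast?_stack_of_run h
  obtain ⟨q, w, _ | ⟨a, v⟩, y, z⟩ := c
  · simp at h_stack
  have escape (hq : q.Active) : ∃ d, S.machine.Step A ⟨q, w, a :: v, y, z⟩ d :=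
    ⟨_, OracleNPDA.Step.move (s := none) (not_mem_halt_of_active hq) (ne_query_of_active hq)
      (.inr ⟨rfl, rfl⟩)⟩
  cases q with
  | accept => exact .inl (.inl rfl)
  | reject => exact .inl (.inr rfl)
  | query => exact .inr (let ⟨b, _, hs⟩ := exists_step_of_query w (a :: v) y z; ⟨_, hs⟩)
  | start => exact .inr (escape trivial)
  | run => exact .inr (escape trivial)
  | answer => exact .inr (escape trivial)

theorem not_mem_halt_of_step {c d : S.machine.Cfg} (h : S.machine.Step A c d) :
    c.state ∉ S.machine.halt := by
  cases h with
  | read h_halt | silent h_halt => exact h_halt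
  | answerYes | answerNo => rintro (h | h) <;> cases h

theorem machine_terminates {a b : ℕ}
    (h : ∀ (A : Language Ω) (x : List α) (t : ℕ) (c : S.machine.Cfg),
      S.machine.Run A t (S.machine.init x) c → c.state ∉ S.machine.halt → t ≤ a * x.length + b) :
    S.machine.Terminates := by
  refine ⟨a, b + 1, fun A x t c hr => ⟨?_, mem_halt_or_exists_step hr⟩⟩
  cases hr with
  | refl => exact Nat.zero_le _
  | tail hr hs => exact Nat.succ_le_succ (h A x _ _ hr (not_mem_halt_of_step hs))

end Skeleton

/-- A pushdown transducer that reads words over `α` and writes words over `Ω`. It knows the end of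
its input: `final` depends on the state and on the topmost stack symbol at the end. The second
argument of `δ` is `none` for silent moves, the topmost stack symbol is `none` on the empty stack,
and silent moves lower the rank of the state, so that there are boundedly many of them in a row. -/
structure PushdownTransducer (α Ω : Type) where
  State : Type
  Stack : Type
  finite_state : Finite State
  finite_stack : Finite Stack
  δ : State → Option α → Option Stack → Set (State × List Stack × Option Ω)
  finite_δ : ∀ q s a, (δ q s a).Finite
  start : State
  final : State → Option Stack → Prop
  rank : State → ℕ
  rank_lt : ∀ {q a r}, r ∈ δ q none a → rank r.1 < rank q

namespace PushdownTransducer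

variable {α Ω : Type}

/-- `P.Reach x q v y`: having read `x`, the transducer `P` can be in state `q` with stack `v` and
output `y`. -/
inductive Reach (P : PushdownTransducer α Ω) : List α → P.State → List P.Stack → List Ω → Prop
  | init : Reach P [] P.start [] []
  | move {x q v y s p u b} (h : Reach P x q v y) (h' : (p, u, b) ∈ P.δ q s v.head?) :
      Reach P (x ++ s.toList) p (u ++ v.tail) (y ++ b.toList)

/-- The relation computed by a pushdown transducer. -/
def Transduces (P : PushdownTransducer α Ω) (x : List α) (y : List Ω) : Prop :=
  ∃ q v, P.Reach x q v y ∧ P.final q v.head?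

/-- The stack `v` above the bottom mark `none`. -/
def markBottom {S : Type} (v : List S) : List (Option S) :=
  v.map some ++ [none]

/-- What a machine has to push for `u` when it has popped `a` from a stack with a bottom mark. -/
def repush {S : Type} (u : List S) (a : Option S) : List (Option S) :=
  u.map some ++ if a = none then [none] else []

theorem markBottom_eq_cons {S : Type} (v : List S) :
    ∃ t, markBottom v = v.head? :: t ∧ ∀ u, repush u v.head? ++ t = markBottom (u ++ v.tail) := by
  cases v with
  | nil => exact ⟨[], rfl, by simp [repush, markBottom]⟩
  | cons a v => exact ⟨markBottom v, rfl, by simp [repush, markBottom]⟩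

/-- The transitions of the machine that submits the output of `P` to the oracle and accepts the
answers in `V`. -/
inductive Trans (P : PushdownTransducer α Ω) (V : Set Bool) :
    Control P.State → Option (TapeSym α) → Option P.Stack →
      Control P.State × List (Option P.Stack) × Option Ω × Option Empty → Prop
  | start (a) : Trans P V .start (some .left) a (.run P.start, [a], none, none)
  | move {q s a p u b} (h : (p, u, b) ∈ P.δ q s a) :
      Trans P V (.run q) (s.map .letter) a (.run p, repush u a, b, none)
  | submit {q a} (h : P.final q a) :
      Trans P V (.run q) (some .right) a (.query, [a], none, none)
  | accept {b} (a) (h : b ∈ V) : Trans P V (.answer b) none a (.accept, [a], none, none)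

theorem exists_push_bound [Finite α] (P : PushdownTransducer α Ω) (V : Set Bool) :
    ∃ n, ∀ q s a r, P.Trans V q s a r → r.2.1.length ≤ n := by
  have := P.finite_state
  have := P.finite_stack
  obtain ⟨n, hn⟩ := exists_bound_of_finite
    (fun i : P.State × Option α × Option P.Stack => P.finite_δ i.1 i.2.1 i.2.2) (·.2.1.length)
  refine ⟨n + 1, fun q s a r h => ?_⟩
  cases h with
  | @move q s a p u b h =>
    have := hn (q, s, a) _ h
    simp only [repush, List.length_append, List.length_map]
    split <;> simp_all; omega
  | _ => simp

/-- The control structure of the machine that submits the output of `P` to the oracle and accepts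
the answers in `V`. -/
abbrev skeleton [Finite α] (P : PushdownTransducer α Ω) (V : Set Bool) : Skeleton α Ω Empty where
  Work := P.State
  Stack := Option P.Stack
  finite_work := P.finite_state
  finite_stack := have := P.finite_stack; inferInstance
  bottom := none
  Trans := P.Trans V
  exists_push_bound := P.exists_push_bound V
  getLast?_push h := by cases h <;> simp [repush]

variable [Finite α] [Finite Ω] {P : PushdownTransducer α Ω} {V : Set Bool} {A : Language Ω}

/-- An upper bound for the number of steps that can follow a configuration, if `K` is the maximal
rank. -/
def potential (K : ℕ) (c : (P.skeleton V).machine.Cfg) : ℕ :=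
  match c.state with
  | .start => (K + 1) * c.input.length + 3
  | .run q => (K + 1) * c.input.length + P.rank q + 3
  | .query => 2
  | .answer _ => 1
  | .accept | .reject => 0

theorem potential_lt {K : ℕ} (hK : ∀ q, P.rank q ≤ K) {c d : (P.skeleton V).machine.Cfg}
    (h : (P.skeleton V).machine.Step A c d) : potential K d < potential K c := by
  cases h using Skeleton.step_cases with
  | @trans _ _ w _ _ _ _ _ h =>
    cases h with
    | start =>
      have := hK P.start
      simp only [potential, Option.toList_some, List.singleton_append, List.length_cons, mul_add]
      omega
    | @move q s a p u b h =>
      cases s with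
      | none =>
        have := P.rank_lt h
        simp_all [potential]
      | some =>
        have := hK p
        simp only [potential, Option.map_some, Option.toList_some, List.singleton_append,
          List.length_cons, mul_add]
        omega
    | submit => simp only [potential]; omega
    | accept => simp [potential]
  | @escape q _ _ _ _ _ _ _ hq => cases q <;> simp_all [potential, Control.Active]
  | answer => simp [potential]

theorem machine_terminates (P : PushdownTransducer α Ω) (V : Set Bool) :
    (P.skeleton V).machine.Terminates := by
  have := P.finite_state
  obtain ⟨K, hK⟩ := (Set.finite_range P.rank).bddAbove
  refine Skeleton.machine_terminates (a := K + 1) (b := 2 * (K + 1) + 3) fun A x t c h _ => ?_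
  have := h.add_potential_le (fun hs => potential_lt (fun q => hK ⟨q, rfl⟩) hs)
  calc t ≤ potential K ((P.skeleton V).machine.init x) := by omega
    _ = _ := by simp only [potential, OracleNPDA.init, inputTape, List.length_cons,
                  List.length_append, List.length_map, List.length_nil]; ring

/-- What is known about the configurations that can be reached on input `x`. -/
def Invariant (A : Language Ω) (x : List α) (c : (P.skeleton V).machine.Cfg) : Prop :=
  match c.state with
  | .start => c = (P.skeleton V).machine.init x
  | .run q => ∃ x₁ x₂ v, x = x₁ ++ x₂ ∧ P.Reach x₁ q v c.queryTape ∧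
      c.input = x₂.map .letter ++ [.right] ∧ c.stack = markBottom v
  | .query => P.Transduces x c.queryTape
  | .answer b => ∃ y, P.Transduces x y ∧ (b = true ↔ y ∈ A)
  | .accept => ∃ y, ∃ b ∈ V, P.Transduces x y ∧ (b = true ↔ y ∈ A)
  | .reject => True

theorem Invariant.trans {x : List α} {q : Control P.State} {s : Option (TapeSym α)}
    {w : List (TapeSym α)} {a : Option P.Stack} {v : List (Option P.Stack)} {y : List Ω}
    {z : List Empty} {r} (hc : Invariant (V := V) A x ⟨q, s.toList ++ w, a :: v, y, z⟩)
    (h : P.Trans V q s a r) :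
    Invariant (V := V) A x
      ⟨r.1, w, r.2.1 ++ v, y ++ r.2.2.1.toList, z ++ r.2.2.2.toList⟩ := by
  cases h with
  | start =>
    cases hc
    exact ⟨[], x, [], rfl, .init, rfl, rfl⟩
  | accept _ hb =>
    obtain ⟨y, hy, hA⟩ := hc
    exact ⟨y, _, hb, hy, hA⟩
  | @move q s a p u b h =>
    obtain ⟨x₁, x₂, v', rfl, hR, hw, hv⟩ := hc
    obtain ⟨t, ht, hu⟩ := markBottom_eq_cons v'
    obtain ⟨rfl, rfl⟩ : a = v'.head? ∧ v = t := by simpa [ht] using hv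
    obtain ⟨x₃, rfl, rfl⟩ : ∃ x₃, x₂ = s.toList ++ x₃ ∧ w = x₃.map .letter ++ [.right] := by
      cases s with
      | none => exact ⟨x₂, rfl, by simpa using hw⟩
      | some s => cases x₂ <;> simp_all
    exact ⟨x₁ ++ s.toList, x₃, u ++ v'.tail, by simp, hR.move h, rfl, hu u⟩
  | @submit q a hf =>
    obtain ⟨x₁, x₂, v', rfl, hR, hw, hv⟩ := hc
    obtain ⟨t, ht, -⟩ := markBottom_eq_cons v'
    obtain ⟨rfl, rfl⟩ : a = v'.head? ∧ v = t := by simpa [ht] using hv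
    obtain rfl : x₂ = [] := by cases x₂ <;> simp_all
    exact ⟨q, v', by simpa using hR, hf⟩

theorem invariant_of_run {x : List α} {t : ℕ} {c : (P.skeleton V).machine.Cfg}
    (h : (P.skeleton V).machine.Run A t ((P.skeleton V).machine.init x) c) : Invariant A x c := by
  refine h.invariant (I := fun _ => Invariant A x) (fun hc hs => ?_) rfl
  cases hs using Skeleton.step_cases with
  | trans h => exact hc.trans h
  | escape => trivial
  | answer h => exact ⟨_, hc, h⟩

theorem exists_run_of_reach (V : Set Bool) (A : Language Ω) {x : List α} {q : P.State}
    {v : List P.Stack} {y : List Ω} (h : P.Reach x q v y) (x' : List α) :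
    ∃ t, (P.skeleton V).machine.Run A t ((P.skeleton V).machine.init (x ++ x'))
      ⟨.run q, x'.map .letter ++ [.right], markBottom v, y, []⟩ := by
  induction h generalizing x' with
  | init => exact ⟨1, .single (Skeleton.step_of_trans (S := P.skeleton V) (.start none))⟩
  | @move x q v y s p u b _ h ih =>
    obtain ⟨t, ht⟩ := ih (s.toList ++ x')
    obtain ⟨v', hv, hu⟩ := markBottom_eq_cons v
    have h_step := Skeleton.step_of_trans (S := P.skeleton V) (A := A)
      (w := x'.map .letter ++ [.right]) (v := v') (y := y) (z := []) (.move h)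
    rw [hu] at h_step
    rw [hv] at ht
    refine ⟨t + 1, .tail ?_ h_step⟩
    cases s <;> simpa using ht

theorem mem_accepts_machine {x : List α} : x ∈ (P.skeleton V).machine.accepts A ↔
    ∃ y, ∃ b ∈ V, P.Transduces x y ∧ (b = true ↔ y ∈ A) := by
  constructor
  · rintro ⟨t, ⟨q, _, _, _, _⟩, h, rfl : q = _⟩
    exact invariant_of_run h
  · rintro ⟨y, b, hb, ⟨q, v, hR, hf⟩, hA⟩
    obtain ⟨t, ht⟩ := exists_run_of_reach V A hR []
    obtain ⟨v', hv, -⟩ := markBottom_eq_cons v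
    rw [hv, List.append_nil] at ht
    have submit := Skeleton.step_of_trans (S := P.skeleton V) (A := A) (w := []) (v := v')
      (y := y) (z := []) (.submit hf)
    have answer := Skeleton.step_of_mem_iff (S := P.skeleton V) (A := A) (w := [])
      (v := v.head? :: v') (y := y) (z := []) hA
    have accept := Skeleton.step_of_trans (S := P.skeleton V) (A := A) (w := []) (v := v')
      (y := []) (z := []) (.accept v.head? hb)
    exact ⟨_, _, ((ht.tail submit).tail (by simpa using answer)).tail accept, rfl⟩

theorem transduces_mem_recog (P : PushdownTransducer α Ω) (V : Set Bool) (A : Language Ω) :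
    {x | ∃ y, ∃ b ∈ V, P.Transduces x y ∧ (b = true ↔ y ∈ A)} ∈ Recog A α :=
  ⟨(P.skeleton V).machine, P.machine_terminates V, Set.ext fun _ => mem_accepts_machine.symm⟩

theorem exists_transduces_mem_recog (P : PushdownTransducer α Ω) (A : Language Ω) :
    {x | ∃ y, P.Transduces x y} ∈ Recog A α := by
  have exists_answer (y : List Ω) : ∃ b : Bool, b = true ↔ y ∈ A := by
    by_cases hA : y ∈ A
    exacts [⟨true, by simpa⟩, ⟨false, by simpa⟩]
  convert P.transduces_mem_recog Set.univ A using 1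
  ext x
  constructor
  · rintro ⟨y, h⟩
    obtain ⟨b, hb⟩ := exists_answer y
    exact ⟨y, b, trivial, h, hb⟩
  · rintro ⟨y, b, -, h, -⟩
    exact ⟨y, h⟩

end PushdownTransducer

/-- How much of its input tape a simulated machine has read: nothing, the left endmarker,
everything. -/
inductive Phase : Type
  | pre
  | mid
  | post

instance : Finite Phase :=
  Finite.of_injective (β := Fin 3) (fun | .pre => 0 | .mid => 1 | .post => 2)
    (by rintro (_ | _ | _) (_ | _ | _) h <;> simp_all)

section Feeding

variable {α β : Type}

/-- The letters in a word that `f` yields before it signals an end by `some none`; symbols with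
value `none` are skipped. -/
def extract (f : β → Option (Option α)) : List β → List α
  | [] => []
  | b :: v => match f b with
    | none => extract f v
    | some none => []
    | some (some a) => a :: extract f v

theorem extract_length_le (f : β → Option (Option α)) (v : List β) :
    (extract f v).length ≤ v.length := by
  induction v with
  | nil => rfl
  | cons b v ih =>
    rw [extract]
    split <;> simp only [List.length_cons, List.length_nil] <;> omega

/-- The rest of the input tape of the simulated machine, once its left endmarker has been read, if
`w` is the rest of the actual input tape. -/
def feedTape (f : β → Option (Option α)) : List (TapeSym β) → List (TapeSym α)
  | .letter b :: w => match f b with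
    | none => feedTape f w
    | some none => [.right]
    | some (some a) => .letter a :: feedTape f w
  | .right :: _ => [.right]
  | .left :: _ | [] => []

theorem feedTape_map_letter (f : β → Option (Option α)) (r : List β) :
    feedTape f (r.map .letter ++ [.right]) = (extract f r).map .letter ++ [.right] := by
  induction r with
  | nil => rfl
  | cons b r ih =>
    rw [List.map_cons, List.cons_append, feedTape, extract]
    split <;> simp [ih]

namespace Phase

/-- The rest of the input tape of the simulated machine in each phase, if `w` is the rest of the
actual input tape. -/
def view (f : β → Option (Option α)) (ph : Phase) (w : List (TapeSym β)) : List (TapeSym α) :=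
  match ph with
  | pre => .left :: feedTape f w
  | mid => feedTape f w
  | post => []

/-- `Feed f ph s s' ph'`: when `s` is read, the simulated machine reads `s'`, and the phase changes
from `ph` to `ph'`. -/
inductive Feed (f : β → Option (Option α)) :
    Phase → Option (TapeSym β) → Option (TapeSym α) → Phase → Prop
  | silent (ph) : Feed f ph none none ph
  | left : Feed f pre none (some .left) mid
  | letter {b a} (h : f b = some (some a)) :
      Feed f mid (some (.letter b)) (some (.letter a)) mid
  | finish {b} (h : f b = some none) : Feed f mid (some (.letter b)) (some .right) post
  | right : Feed f mid (some .right) (some .right) post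

variable {f : β → Option (Option α)} {ph : Phase}

theorem view_pre_map_letter (f : β → Option (Option α)) (r : List β) :
    view f pre (r.map .letter ++ [.right]) = inputTape (extract f r) := by
  rw [view, feedTape_map_letter, inputTape]

theorem view_letter_cons {b : β} (h : f b = none) (w : List (TapeSym β)) :
    view f ph (.letter b :: w) = view f ph w := by
  cases ph <;> simp [view, feedTape, h]

theorem Feed.view_eq {ph' : Phase} {s : Option (TapeSym β)} {s' : Option (TapeSym α)}
    (h : Feed f ph s s' ph') (w : List (TapeSym β)) :
    view f ph (s.toList ++ w) = s'.toList ++ view f ph' w := by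
  cases h <;> simp_all [view, feedTape]

theorem exists_feed_of_feedTape {w : List (TapeSym β)} {s' : TapeSym α} {w' : List (TapeSym α)}
    (h : feedTape f w = s' :: w') : ∃ (u : List β) (s : Option (TapeSym β)) (ph' : Phase)
      (w₁ : List (TapeSym β)), w = u.map .letter ++ (s.toList ++ w₁) ∧ (∀ b ∈ u, f b = none) ∧
        Feed f mid s (some s') ph' ∧ view f ph' w₁ = w' := by
  induction w with
  | nil => simp [feedTape] at h
  | cons s w ih =>
    cases s with
    | left => simp [feedTape] at h
    | right =>
      obtain ⟨rfl, rfl⟩ : .right = s' ∧ [] = w' := by simpa [feedTape] using h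
      exact ⟨[], _, _, w, rfl, by simp, .right, rfl⟩
    | letter b =>
      rcases hb : f b with _ | _ | a <;> simp only [feedTape, hb, List.cons.injEq] at h
      · obtain ⟨u, s, ph', w₁, rfl, hu, h_feed⟩ := ih h
        exact ⟨b :: u, s, ph', w₁, rfl, by simp_all, h_feed⟩
      · obtain ⟨rfl, rfl⟩ := h
        exact ⟨[], _, _, w, rfl, by simp, .finish hb, rfl⟩
      · obtain ⟨rfl, rfl⟩ := h
        exact ⟨[], _, _, w, rfl, by simp, .letter hb, rfl⟩

theorem exists_feed {w : List (TapeSym β)} {s' : Option (TapeSym α)} {w' : List (TapeSym α)}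
    (h : view f ph w = s'.toList ++ w') : ∃ (u : List β) (s : Option (TapeSym β)) (ph' : Phase)
      (w₁ : List (TapeSym β)), w = u.map .letter ++ (s.toList ++ w₁) ∧ (∀ b ∈ u, f b = none) ∧
        Feed f ph s s' ph' ∧ view f ph' w₁ = w' := by
  cases s' with
  | none => exact ⟨[], none, ph, w, rfl, by simp, .silent ph, h⟩
  | some s' =>
    cases ph with
    | pre =>
      obtain ⟨rfl, rfl⟩ : .left = s' ∧ feedTape f w = w' := by simpa [view] using h
      exact ⟨[], none, mid, w, rfl, by simp, .left, rfl⟩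
    | mid => exact exists_feed_of_feedTape h
    | post => simp [view] at h

end Phase

end Feeding

theorem eq_of_inputTape_eq_append_left {α : Type} {x : List α} {u r : List (TapeSym α)}
    (h : inputTape x = u ++ .left :: r) : r = x.map .letter ++ [.right] := by
  cases u with
  | nil => simpa [inputTape] using h.symm
  | cons s u =>
    have : (TapeSym.left : TapeSym α) ∈ x.map .letter ++ [.right] := by
      rw [(List.cons.inj h).2]
      simp
    simp at this

theorem exists_of_inputTape_eq_append_letter {α : Type} {x : List α} {u r : List (TapeSym α)}
    {b : α} (h : inputTape x = u ++ .letter b :: r) :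
    ∃ u' r', x = u' ++ b :: r' ∧ r = r'.map .letter ++ [.right] := by
  obtain _ | ⟨s, u⟩ := u
  · simp [inputTape] at h
  replace h : x.map .letter ++ [.right] = u ++ .letter b :: r := (List.cons.inj h).2
  induction x generalizing u with
  | nil => cases u <;> simp at h
  | cons a x ih =>
    cases u with
    | nil =>
      obtain ⟨rfl, rfl⟩ : a = b ∧ x.map .letter ++ [.right] = r := by simpa using h
      exact ⟨[], x, rfl, rfl⟩
    | cons s' u =>
      obtain ⟨u', r', rfl, rfl⟩ := ih u (List.cons.inj h).2
      exact ⟨a :: u', r', rfl, rfl⟩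

/-- A finite family of machines that can be started, nondeterministically, after the left
endmarker or after certain letters of an input over `β` (`launch`); from then on, the machine
works on the letters that `feed` extracts from the rest of the input.  Its queries are translated
by `emb` and start with the symbol `tag`, and `out` is written on the output tape. -/
structure Bundle (ι : Type) (α Ω : ι → Type) (β Ω' Γ : Type) where
  M : ∀ i, OracleNPDA (α i) (Ω i) Empty
  launch : ι → Option β → Prop
  feed : ∀ i, β → Option (Option (α i))
  tag : ι → Option Ω'
  emb : ∀ i, Ω i → Ω'
  out : ι → Option Γ

namespace Bundle

variable {ι : Type} {α Ω : ι → Type} {β Ω' Γ : Type}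

/-- On input `x`, the machine `i` can be launched with `r` as the rest of the input. -/
def Launches (B : Bundle ι α Ω β Ω' Γ) (i : ι) (x r : List β) : Prop :=
  (B.launch i none ∧ r = x) ∨ ∃ u b, x = u ++ b :: r ∧ B.launch i (some b)

/-- The query by which `y` is asked on behalf of the machine `i`. -/
def ask (B : Bundle ι α Ω β Ω' Γ) (i : ι) (y : List (Ω i)) : List Ω' :=
  (B.tag i).toList ++ y.map (B.emb i)

/-- The oracle for the machine `i` that results from an oracle for the bundle. -/
def oracle (B : Bundle ι α Ω β Ω' Γ) (A : Language Ω') (i : ι) : Language (Ω i) :=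
  {y | B.ask i y ∈ A}

theorem oracle_eq_self {B : Bundle ι α (fun _ => Ω') β Ω' Γ} {i : ι}
    (h_tag : B.tag i = none) (h_emb : B.emb i = id) (A : Language Ω') : B.oracle A i = A :=
  Set.ext fun y => by change _ ++ _ ∈ A ↔ y ∈ A; simp [h_tag, h_emb]

/-- The computations of the machine `i` that `B` can simulate on input `x`. -/
def Simulates (B : Bundle ι α Ω β Ω' Γ) (A : Language Ω') (x : List β) (i : ι) (n : ℕ)
    (d : (B.M i).Cfg) : Prop :=
  ∃ r, B.Launches i x r ∧
    (B.M i).Run (B.oracle A i) n ((B.M i).init (extract (B.feed i) r)) d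

variable {B : Bundle ι α Ω β Ω' Γ} {A : Language Ω'} {x : List β}

theorem Launches.length_le {i : ι} {x r : List β} (h : B.Launches i x r) : r.length ≤ x.length := by
  rcases h with ⟨-, rfl⟩ | ⟨u, b, rfl, -⟩
  · exact le_rfl
  · simp only [List.length_append, List.length_cons]
    omega

theorem Simulates.tail {i : ι} {n : ℕ} {d e : (B.M i).Cfg} (h : B.Simulates A x i n d)
    (hs : (B.M i).Step (B.oracle A i) d e) : B.Simulates A x i (n + 1) e := by
  obtain ⟨r, hl, hr⟩ := h
  exact ⟨r, hl, hr.tail hs⟩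

theorem ask_append (i : ι) (y : List (Ω i)) (b : Option (Ω i)) :
    B.ask i (y ++ b.toList) = B.ask i y ++ (b.map (B.emb i)).toList := by
  cases b <;> simp [ask]

theorem exists_simulates_le [Finite ι] (h : ∀ i, (B.M i).Terminates) :
    ∃ a b, ∀ A x i n d, B.Simulates A x i n d → n ≤ a * x.length + b := by
  choose a b hab using h
  obtain ⟨a', ha⟩ := (Set.finite_range a).bddAbove
  obtain ⟨b', hb⟩ := (Set.finite_range b).bddAbove
  refine ⟨a', b', ?_⟩
  rintro A x i n d ⟨r, hl, hr⟩
  calc n ≤ a i * (extract (B.feed i) r).length + b i := (hab i _ _ _ _ hr).1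
    _ ≤ a' * x.length + b' := by
      gcongr
      exacts [ha ⟨i, rfl⟩, (extract_length_le _ _).trans hl.length_le, hb ⟨i, rfl⟩]

/-- Stack symbols of the machine executing a bundle: the bottom mark, the memory for the simulated
machine and its phase during a query, the stack symbols of the simulated machines. -/
inductive Sk (B : Bundle ι α Ω β Ω' Γ) : Type
  | floor
  | token (i : ι) (ph : Phase)
  | sym (i : ι) (a : (B.M i).Stack)

/-- The stack of the machine executing a bundle. -/
def floorStack (B : Bundle ι α Ω β Ω' Γ) (i : ι) (v : List (B.M i).Stack) : List B.Sk :=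
  v.map (.sym i) ++ [.floor]

theorem floorStack_eq_cons (i : ι) (v : List (B.M i).Stack) : ∃ a t, B.floorStack i v = a :: t := by
  cases v <;> simp [floorStack]

/-- The states of the simulated machines, with phases. -/
abbrev Work (B : Bundle ι α Ω β Ω' Γ) : Type :=
  Σ i, Phase × (B.M i).State

/-- Transitions of the machine executing a bundle. -/
inductive Trans (B : Bundle ι α Ω β Ω' Γ) : Control B.Work → Option (TapeSym β) → B.Sk →
    Control B.Work × List B.Sk × Option Ω' × Option Γ → Prop
  | wait (s a) : Trans B .start (some s) a (.start, [a], none, none)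
  | launchLeft {i} (a) (h : B.launch i none) :
      Trans B .start (some .left) a
        (.run ⟨i, .pre, (B.M i).start⟩, [.sym i (B.M i).bottom, a], B.tag i, B.out i)
  | launchLetter {i b} (a) (h : B.launch i (some b)) :
      Trans B .start (some (.letter b)) a
        (.run ⟨i, .pre, (B.M i).start⟩, [.sym i (B.M i).bottom, a], B.tag i, B.out i)
  | accept {i ph q} (a) (h : q ∈ (B.M i).acc) :
      Trans B (.run ⟨i, ph, q⟩) none a (.accept, [a], none, none)
  | ask (i ph a) :
      Trans B (.run ⟨i, ph, (B.M i).query⟩) none a (.query, [.token i ph, a], none, none)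
  | resume (b i ph) :
      Trans B (.answer b) none (.token i ph) (.run ⟨i, ph, (B.M i).reply b⟩, [], B.tag i, none)
  | skip {i b} (ph q a) (h : B.feed i b = none) :
      Trans B (.run ⟨i, ph, q⟩) (some (.letter b)) a (.run ⟨i, ph, q⟩, [a], none, none)
  | move {i ph s s' ph' q a p u b o} (h_feed : Phase.Feed (B.feed i) ph s s' ph')
      (h_halt : q ∉ (B.M i).halt) (h_query : q ≠ (B.M i).query)
      (h : (p, u, b, o) ∈ (B.M i).δ q s' a) :
      Trans B (.run ⟨i, ph, q⟩) s (.sym i a)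
        (.run ⟨i, ph', p⟩, u.map (.sym i), b.map (B.emb i), none)

theorem exists_push_bound [Finite ι] [∀ i, Finite (α i)] (B : Bundle ι α Ω β Ω' Γ) :
    ∃ n, ∀ q s a r, B.Trans q s a r → r.2.1.length ≤ n := by
  have := fun i => (B.M i).finite_state
  have := fun i => (B.M i).finite_stack
  obtain ⟨n, hn⟩ := exists_bound_of_finite
    (fun j : Σ i, ((B.M i).State × Option (TapeSym (α i)) × (B.M i).Stack) =>
      ((B.M j.1).finite_δ j.2.1 j.2.2.1 j.2.2.2).image (·.2.1.length)) id
  refine ⟨n + 2, fun q s a r h => ?_⟩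
  cases h with
  | @move i _ _ s' _ q a _ u _ _ _ _ _ h =>
    have := hn ⟨i, q, s', a⟩ u.length ⟨_, h, rfl⟩
    simp only [List.length_map, id] at this ⊢
    omega
  | _ => simp

/-- The control structure of the machine executing a bundle. -/
abbrev skeleton [Finite ι] [∀ i, Finite (α i)] (B : Bundle ι α Ω β Ω' Γ) :
    Skeleton β Ω' Γ where
  Work := B.Work
  Stack := B.Sk
  finite_work := have := fun i => (B.M i).finite_state; inferInstance
  finite_stack :=
    have := fun i => (B.M i).finite_stack
    Finite.of_injective (β := Option ((ι × Phase) ⊕ Σ i, (B.M i).Stack))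
      (fun | .floor => none | .token i ph => some (.inl (i, ph)) | .sym i a => some (.inr ⟨i, a⟩))
      (by rintro (_ | _ | _) (_ | _ | _) h <;> simp_all)
  bottom := .floor
  Trans := B.Trans
  exists_push_bound := B.exists_push_bound
  getLast?_push h := by cases h <;> simp

variable [Finite ι] [∀ i, Finite (α i)] [Finite Ω'] [Finite Γ]

/-- The configuration in which the machine executing a bundle, with the rest `w` of its input,
simulates the configuration `d` of the machine `i`. -/
abbrev encode (B : Bundle ι α Ω β Ω' Γ) (i : ι) (ph : Phase) (w : List (TapeSym β))
    (d : (B.M i).Cfg) : B.skeleton.machine.Cfg :=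
  ⟨.run ⟨i, ph, d.state⟩, w, B.floorStack i d.stack, B.ask i d.queryTape, (B.out i).toList⟩

/-- What is known about the configurations reached after `t` steps on input `x`: every step uses
up an input symbol or is one of the at most three that account for a step of the simulated
machine. -/
def Invariant (A : Language Ω') (x : List β) (t : ℕ) (c : B.skeleton.machine.Cfg) : Prop :=
  match c.state with
  | .start => ∃ u, inputTape x = u ++ c.input ∧ t = u.length ∧
      c = ⟨.start, c.input, [.floor], [], []⟩
  | .run ⟨i, ph, _⟩ => ∃ w n d, B.Simulates A x i n d ∧ d.input = ph.view (B.feed i) w ∧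
      c = B.encode i ph w d ∧ t + w.length ≤ x.length + 2 + 3 * n
  | .query => ∃ i ph w n d, B.Simulates A x i n d ∧ d.input = ph.view (B.feed i) w ∧
      d.state = (B.M i).query ∧
      c = ⟨.query, w, .token i ph :: B.floorStack i d.stack, B.ask i d.queryTape,
        (B.out i).toList⟩ ∧ t + w.length ≤ x.length + 2 + 3 * n + 1
  | .answer b => ∃ i ph w n d, B.Simulates A x i (n + 1) d ∧ d.input = ph.view (B.feed i) w ∧
      d.state = (B.M i).reply b ∧ d.queryTape = [] ∧
      c = ⟨.answer b, w, .token i ph :: B.floorStack i d.stack, [], (B.out i).toList⟩ ∧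
      t + w.length ≤ x.length + 2 + 3 * n + 2
  | .accept => ∃ i r, B.Launches i x r ∧
      extract (B.feed i) r ∈ (B.M i).accepts (B.oracle A i) ∧ c.output = (B.out i).toList
  | .reject => True

theorem Invariant.launch {t : ℕ} {i : ι} {r : List β} (hl : B.Launches i x r)
    (ht : t + r.length ≤ x.length + 1) : Invariant (B := B) A x t
      ⟨.run ⟨i, .pre, (B.M i).start⟩, r.map .letter ++ [.right], [.sym i (B.M i).bottom, .floor],
        (B.tag i).toList, (B.out i).toList⟩ := by
  refine ⟨r.map (TapeSym.letter (α := β)) ++ [TapeSym.right], 0,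
    (B.M i).init (extract (B.feed i) r), ⟨r, hl, .refl _⟩,
    (Phase.view_pre_map_letter (B.feed i) r).symm, ?_, ?_⟩
  · simp [encode, OracleNPDA.init, floorStack, ask]
  · simp only [List.length_append, List.length_map, List.length_singleton]
    omega

theorem Invariant.trans_start {t : ℕ} {s : Option (TapeSym β)} {w : List (TapeSym β)} {a : B.Sk}
    {v : List B.Sk} {y : List Ω'} {z : List Γ} {r}
    (hc : Invariant (B := B) A x t ⟨.start, s.toList ++ w, a :: v, y, z⟩)
    (h : B.Trans .start s a r) : Invariant (B := B) A x (t + 1)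
      ⟨r.1, w, r.2.1 ++ v, y ++ r.2.2.1.toList, z ++ r.2.2.2.toList⟩ := by
  obtain ⟨u, hx, rfl, hc⟩ := hc
  obtain ⟨rfl, rfl, rfl, rfl⟩ : a = .floor ∧ v = [] ∧ y = [] ∧ z = [] := by
    simpa [and_assoc] using hc
  have h_length := congrArg List.length hx
  simp only [inputTape, List.length_append, List.length_cons, List.length_map, List.length_nil,
    Option.toList] at h_length
  cases h with
  | wait s a => exact ⟨u ++ [s], by simpa using hx, by simp, rfl⟩
  | launchLeft _ hl =>
    obtain rfl := eq_of_inputTape_eq_append_left hx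
    exact .launch (.inl ⟨hl, rfl⟩) (by simp at h_length; omega)
  | launchLetter _ hl =>
    obtain ⟨u', r, rfl, rfl⟩ := exists_of_inputTape_eq_append_letter hx
    exact .launch (.inr ⟨u', _, rfl, hl⟩) (by simp at h_length ⊢; omega)

theorem Invariant.trans_run {t : ℕ} {q : B.Work} {s : Option (TapeSym β)} {w : List (TapeSym β)}
    {a : B.Sk} {v : List B.Sk} {y : List Ω'} {z : List Γ} {r}
    (hc : Invariant (B := B) A x t ⟨.run q, s.toList ++ w, a :: v, y, z⟩)
    (h : B.Trans (.run q) s a r) : Invariant (B := B) A x (t + 1)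
      ⟨r.1, w, r.2.1 ++ v, y ++ r.2.2.1.toList, z ++ r.2.2.2.toList⟩ := by
  obtain ⟨i, ph, q⟩ := q
  obtain ⟨w', n, ⟨q', w₀, v₀, y₀, z₀⟩, hd, h_view, hc, ht⟩ := hc
  simp only [OracleNPDA.Cfg.mk.injEq, Control.run.injEq, Sigma.mk.injEq, heq_eq_eq, true_and,
    Prod.mk.injEq] at hc
  obtain ⟨rfl, rfl, hv, rfl, rfl⟩ := hc
  obtain rfl : w₀ = _ := h_view
  cases h with
  | accept a h =>
    obtain ⟨r, hl, hr⟩ := hd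
    exact ⟨i, r, hl, ⟨n, _, hr, h⟩, by simp⟩
  | ask => exact ⟨i, ph, w, n, _, hd, rfl, rfl, by simp [hv], by simp at ht; omega⟩
  | skip _ _ _ h =>
    exact ⟨w, n, _, hd, Phase.view_letter_cons h w, by simp [hv], by simp at ht; omega⟩
  | @move _ _ _ s' ph' _ a p u b o h_feed h_halt h_query h =>
    obtain _ | ⟨a', v₀⟩ := v₀
    · simp [floorStack] at hv
    obtain ⟨⟨rfl⟩, rfl⟩ := List.cons.inj hv
    rw [h_feed.view_eq] at hd
    refine ⟨w, n + 1, _, hd.tail (.move h_halt h_query h), rfl, ?_, ?_⟩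
    · simp [floorStack, ask_append]
    · simp only [List.length_append] at ht
      omega

theorem Invariant.step {t : ℕ} {c d : B.skeleton.machine.Cfg} (hc : Invariant A x t c)
    (hs : B.skeleton.machine.Step A c d) : Invariant A x (t + 1) d := by
  cases hs using Skeleton.step_cases with
  | @trans q _ _ _ _ _ _ _ h =>
    cases q with
    | start => exact hc.trans_start h
    | run => exact hc.trans_run h
    | query | accept | reject => cases h
    | answer b =>
      cases h with
      | resume _ i ph =>
        obtain ⟨i, ph, w', n, ⟨q, w₀, v₀, y₀, z₀⟩, hd, h_view, rfl, rfl, hc, ht⟩ := hc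
        simp only [OracleNPDA.Cfg.mk.injEq, List.cons.injEq, Sk.token.injEq, true_and] at hc
        obtain ⟨rfl, ⟨⟨rfl, rfl⟩, rfl⟩, rfl, rfl⟩ := hc
        exact ⟨_, n + 1, _, hd, h_view, by simp [ask], by omega⟩
  | escape => trivial
  | @answer w v y z b h =>
    obtain ⟨i, ph, w', n, ⟨q, w₀, v₀, y₀, z₀⟩, hd, h_view, rfl, hc, ht⟩ := hc
    simp only [OracleNPDA.Cfg.mk.injEq, true_and] at hc
    obtain ⟨rfl, rfl, rfl, rfl⟩ := hc
    exact ⟨i, ph, w, n, _, hd.tail (.answer h), h_view, rfl, rfl, rfl, by omega⟩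

theorem invariant_of_run {t : ℕ} {c : B.skeleton.machine.Cfg}
    (h : B.skeleton.machine.Run A t (B.skeleton.machine.init x) c) : Invariant A x t c :=
  h.invariant (I := Invariant A x) Invariant.step ⟨[], rfl, rfl, rfl⟩

theorem machine_terminates (h : ∀ i, (B.M i).Terminates) : B.skeleton.machine.Terminates := by
  obtain ⟨a, b, hab⟩ := exists_simulates_le h
  refine Skeleton.machine_terminates (a := 3 * a + 1) (b := 3 * b + 4) fun A x t c hr h_halt => ?_
  suffices t ≤ x.length + 2 + 3 * (a * x.length + b) + 2 from this.trans (by ring_nf; rfl)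
  have hc := invariant_of_run hr
  obtain ⟨q, w, v, y, z⟩ := c
  cases q with
  | start =>
    obtain ⟨u, hx, rfl, -⟩ := hc
    have := congrArg List.length hx
    simp only [inputTape, List.length_cons, List.length_append, List.length_map] at this
    simp at this
    omega
  | run q =>
    obtain ⟨w, n, d, hd, -, -, ht⟩ := hc
    have := hab _ _ _ _ _ hd
    omega
  | query =>
    obtain ⟨i, ph, w, n, d, hd, -, -, -, ht⟩ := hc
    have := hab _ _ _ _ _ hd
    omega
  | answer b =>
    obtain ⟨i, ph, w, n, d, hd, -, -, -, -, ht⟩ := hc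
    have := hab _ _ _ _ _ hd
    omega
  | accept => exact absurd (.inl rfl) h_halt
  | reject => exact absurd (.inr rfl) h_halt

theorem exists_run_skip {i : ι} {ph : Phase} (w : List (TapeSym β)) (d : (B.M i).Cfg)
    {u : List β} (hu : ∀ b ∈ u, B.feed i b = none) : ∃ t, B.skeleton.machine.Run A t
      (B.encode i ph (u.map .letter ++ w) d) (B.encode i ph w d) := by
  obtain ⟨a, v, hv⟩ := floorStack_eq_cons i d.stack
  induction u with
  | nil => exact ⟨0, .refl _⟩
  | cons b u ih =>
    obtain ⟨t, ht⟩ := ih fun b' hb' => hu b' (.tail b hb')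
    have skip := Skeleton.step_of_trans (S := B.skeleton) (A := A) (w := u.map .letter ++ w)
      (v := v) (y := B.ask i d.queryTape) (z := (B.out i).toList)
      (.skip ph d.state a (hu b (.head u)))
    simp only [List.singleton_append, ← hv, Option.toList_none, List.append_nil] at skip
    exact ⟨1 + t, (OracleNPDA.Run.single skip).trans ht⟩

theorem exists_run_answer {i : ι} {ph : Phase} {w : List (TapeSym β)} {w' : List (TapeSym (α i))}
    {v : List (B.M i).Stack} {y : List (Ω i)} {z : List Empty} {b : Bool}
    (hb : b = true ↔ y ∈ B.oracle A i) : ∃ t, B.skeleton.machine.Run A t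
      (B.encode i ph w ⟨(B.M i).query, w', v, y, z⟩)
      (B.encode i ph w ⟨(B.M i).reply b, w', v, [], z⟩) := by
  obtain ⟨a, v', hv⟩ := floorStack_eq_cons i v
  have ask := Skeleton.step_of_trans (S := B.skeleton) (A := A) (w := w) (v := v')
    (y := B.ask i y) (z := (B.out i).toList) (.ask i ph a)
  have answer := Skeleton.step_of_mem_iff (S := B.skeleton) (A := A) (w := w)
    (v := .token i ph :: B.floorStack i v) (z := (B.out i).toList) hb
  have resume := Skeleton.step_of_trans (S := B.skeleton) (A := A) (w := w)
    (v := B.floorStack i v) (y := []) (z := (B.out i).toList) (.resume b i ph)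
  refine ⟨3, ((OracleNPDA.Run.single ?_).tail answer).tail ?_⟩
  · simpa [encode, hv] using ask
  · simpa [encode, Bundle.ask] using resume

theorem step_of_feed {i : ι} {ph ph' : Phase} {s : Option (TapeSym β)}
    {s' : Option (TapeSym (α i))} {w : List (TapeSym β)} {w' w₁ : List (TapeSym (α i))}
    {q p : (B.M i).State} {a : (B.M i).Stack} {u v : List (B.M i).Stack} {y : List (Ω i)}
    {z z' : List Empty} {b : Option (Ω i)} {o : Option Empty}
    (h_feed : Phase.Feed (B.feed i) ph s s' ph') (h_halt : q ∉ (B.M i).halt)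
    (h_query : q ≠ (B.M i).query) (h : (p, u, b, o) ∈ (B.M i).δ q s' a) :
    B.skeleton.machine.Step A (B.encode i ph (s.toList ++ w) ⟨q, w', a :: v, y, z⟩)
      (B.encode i ph' w ⟨p, w₁, u ++ v, y ++ b.toList, z'⟩) := by
  have := Skeleton.step_of_trans (S := B.skeleton) (A := A) (w := w) (v := B.floorStack i v)
    (y := B.ask i y) (z := (B.out i).toList) (.move h_feed h_halt h_query h)
  simpa [encode, floorStack, ask_append] using this

theorem exists_run_of_step {i : ι} {ph : Phase} {w : List (TapeSym β)} {d e : (B.M i).Cfg}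
    (hs : (B.M i).Step (B.oracle A i) d e) (h_view : d.input = ph.view (B.feed i) w) :
    ∃ t ph' w', e.input = ph'.view (B.feed i) w' ∧
      B.skeleton.machine.Run A t (B.encode i ph w d) (B.encode i ph' w' e) := by
  cases hs using OracleNPDA.Step.move_or_answer with
  | answer h =>
    obtain ⟨t, ht⟩ := exists_run_answer h
    exact ⟨t, ph, w, h_view, ht⟩
  | move h_halt h_query h =>
    obtain ⟨u, s, ph', w', rfl, hu, h_feed, rfl⟩ := Phase.exists_feed h_view.symm
    obtain ⟨t, ht⟩ := exists_run_skip (s.toList ++ w') _ hu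
    exact ⟨t + 1, ph', w', rfl, ht.tail (step_of_feed h_feed h_halt h_query h)⟩

theorem exists_run_of_run {i : ι} {r : List β} {n : ℕ} {d : (B.M i).Cfg}
    (h : (B.M i).Run (B.oracle A i) n ((B.M i).init (extract (B.feed i) r)) d) :
    ∃ t ph w, d.input = ph.view (B.feed i) w ∧ B.skeleton.machine.Run A t
      (B.encode i .pre (r.map .letter ++ [.right]) ((B.M i).init (extract (B.feed i) r)))
      (B.encode i ph w d) := by
  refine h.invariant (I := fun _ d => ∃ t ph w, d.input = ph.view (B.feed i) w ∧
    B.skeleton.machine.Run A t _ (B.encode i ph w d)) ?_ ?_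
  · rintro _ d e ⟨t, ph, w, h_view, hr⟩ hs
    obtain ⟨t', ph', w', h_view', hr'⟩ := exists_run_of_step hs h_view
    exact ⟨t + t', ph', w', h_view', hr.trans hr'⟩
  · exact ⟨0, .pre, _, (Phase.view_pre_map_letter (B.feed i) r).symm, .refl _⟩

theorem exists_run_wait (u w : List (TapeSym β)) : ∃ t, B.skeleton.machine.Run A t
    ⟨.start, u ++ w, [.floor], [], []⟩ ⟨.start, w, [.floor], [], []⟩ := by
  induction u with
  | nil => exact ⟨0, .refl _⟩
  | cons s u ih =>
    obtain ⟨t, ht⟩ := ih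
    exact ⟨1 + t, (OracleNPDA.Run.single (Skeleton.step_of_trans (S := B.skeleton)
      (.wait s .floor))).trans ht⟩

theorem exists_run_launch (A : Language Ω') {i : ι} {r : List β} (hl : B.Launches i x r) :
    ∃ t, B.skeleton.machine.Run A t (B.skeleton.machine.init x)
      (B.encode i .pre (r.map .letter ++ [.right]) ((B.M i).init (extract (B.feed i) r))) := by
  have h_encode : B.encode i .pre (r.map .letter ++ [.right])
      ((B.M i).init (extract (B.feed i) r)) = ⟨.run ⟨i, .pre, (B.M i).start⟩,
        r.map .letter ++ [.right], [.sym i (B.M i).bottom, .floor], (B.tag i).toList,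
        (B.out i).toList⟩ := by simp [encode, OracleNPDA.init, floorStack, ask]
  rw [h_encode]
  rcases hl with ⟨hl, rfl⟩ | ⟨u, b, rfl, hl⟩
  · exact ⟨1, .single (Skeleton.step_of_trans (S := B.skeleton) (.launchLeft .floor hl))⟩
  · obtain ⟨t, ht⟩ := exists_run_wait (B := B) (A := A) (.left :: u.map .letter)
      (.letter b :: (r.map .letter ++ [.right]))
    refine ⟨t + 1, .tail ?_ (Skeleton.step_of_trans (S := B.skeleton) (v := []) (y := [])
      (z := []) (w := r.map .letter ++ [.right]) (.launchLetter .floor hl))⟩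
    simpa [OracleNPDA.init, inputTape] using ht

theorem mem_outcomes_machine {z : List Γ} : z ∈ B.skeleton.machine.outcomes A x ↔
    ∃ i r, B.Launches i x r ∧ extract (B.feed i) r ∈ (B.M i).accepts (B.oracle A i) ∧
      z = (B.out i).toList := by
  constructor
  · rintro ⟨t, ⟨q, _, _, _, _⟩, hr, rfl : q = _, rfl⟩
    exact invariant_of_run hr
  · rintro ⟨i, r, hl, ⟨n, d, hr, hd⟩, rfl⟩
    obtain ⟨t, ht⟩ := exists_run_launch A hl
    obtain ⟨t', ph, w, -, ht'⟩ := exists_run_of_run hr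
    obtain ⟨a, v, hv⟩ := floorStack_eq_cons i d.stack
    simp only [encode, hv] at ht'
    exact ⟨_, _, (ht.trans ht').tail (Skeleton.step_of_trans (S := B.skeleton) (s := none)
      (.accept a hd)), rfl, by simp⟩

theorem mem_accepts_machine : x ∈ B.skeleton.machine.accepts A ↔
    ∃ i r, B.Launches i x r ∧ extract (B.feed i) r ∈ (B.M i).accepts (B.oracle A i) := by
  constructor
  · rintro ⟨t, c, hr, hc⟩
    obtain ⟨i, r, hl, h, -⟩ := mem_outcomes_machine.1 ⟨t, c, hr, hc, rfl⟩
    exact ⟨i, r, hl, h⟩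
  · rintro ⟨i, r, hl, h⟩
    obtain ⟨t, c, hr, hc, -⟩ := mem_outcomes_machine.2 ⟨i, r, hl, h, rfl⟩
    exact ⟨t, c, hr, hc⟩

end Bundle

section Closure

theorem extract_map_some {α β : Type} (f : β → Option α) (w : List β) :
    extract (fun b => (f b).map some) w = w.filterMap f := by
  induction w with
  | nil => rfl
  | cons b w ih =>
    rw [extract, List.filterMap_cons]
    cases f b <;> simp [ih]

/-- The transducer that copies its input. -/
abbrev copier (Ω : Type) : PushdownTransducer Ω Ω where
  State := Unit
  Stack := Empty
  finite_state := inferInstance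
  finite_stack := inferInstance
  δ _ a _ := {r | a ≠ none ∧ r = ((), [], a)}
  finite_δ _ a _ := (Set.finite_singleton ((), [], a)).subset fun _ h => h.2
  start := ()
  final _ _ := True
  rank _ := 0
  rank_lt h := absurd rfl h.1

theorem copier_transduces {Ω : Type} {w y : List Ω} : (copier Ω).Transduces w y ↔ y = w := by
  constructor
  · rintro ⟨q, v, h, -⟩
    induction h with
    | init => rfl
    | move _ h ih =>
      obtain ⟨-, h⟩ := h
      cases h
      rw [ih]
  · rintro rfl
    suffices h : (copier Ω).Reach y () [] y from ⟨_, _, h, trivial⟩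
    induction y using List.reverseRecOn with
    | nil => exact .init
    | append_singleton y a ih =>
      exact .move (s := some a) ih (p := ()) (u := []) (b := some a) ⟨by simp, rfl⟩

variable {β Ω : Type} [Finite Ω] {A : Language Ω}

theorem recog_iUnion_segment {ι : Type} [Finite ι] {α : ι → Type} [∀ i, Finite (α i)]
    {L : ∀ i, Language (α i)} (hL : ∀ i, L i ∈ Recog A (α i)) (launch : ι → Option β → Prop)
    (feed : ∀ i, β → Option (Option (α i))) :
    {x | ∃ i r, ((launch i none ∧ r = x) ∨ ∃ u b, x = u ++ b :: r ∧ launch i (some b)) ∧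
      extract (feed i) r ∈ L i} ∈ Recog A β := by
  choose M hM hL using hL
  let B : Bundle ι α (fun _ => Ω) β Ω Empty :=
    ⟨M, launch, feed, fun _ => none, fun _ => id, fun _ => none⟩
  have oracle_eq (i : ι) : B.oracle A i = A := B.oracle_eq_self rfl rfl A
  refine ⟨_, B.machine_terminates hM, Set.ext fun x => Iff.trans ?_ Bundle.mem_accepts_machine.symm⟩
  simp only [oracle_eq, hL]
  rfl

theorem recog_iUnion_comap {ι : Type} [Finite ι] {α : ι → Type} [∀ i, Finite (α i)]
    {L : ∀ i, Language (α i)} (hL : ∀ i, L i ∈ Recog A (α i)) (f : ∀ i, β → Option (α i)) :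
    {w | ∃ i, w.filterMap (f i) ∈ L i} ∈ Recog A β := by
  convert recog_iUnion_segment hL (fun _ b => b = none) (fun i b => (f i b).map some) using 1
  simp [extract_map_some]

theorem recog_comap {α : Type} [Finite α] {L : Language α} (hL : L ∈ Recog A α)
    (f : β → Option α) : {w | w.filterMap f ∈ L} ∈ Recog A β := by
  simpa using recog_iUnion_comap (ι := Unit) (fun _ => hL) (fun _ => f)

theorem recog_union [Finite β] {L L' : Language β} (h : L ∈ Recog A β) (h' : L' ∈ Recog A β) :
    (L ∪ L' : Set (List β)) ∈ Recog A β := by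
  have hL (i : Bool) : (bif i then L' else L) ∈ Recog A β := by cases i <;> assumption
  convert recog_iUnion_comap hL (fun _ => some) using 1
  ext w
  change w ∈ L ∨ w ∈ L' ↔ ∃ i : Bool, w.filterMap some ∈ bif i then L' else L
  simp

theorem recog_self (A : Language Ω) : A ∈ Recog A Ω := by
  have h := (copier Ω).transduces_mem_recog {true} A
  simp only [copier_transduces, Set.mem_singleton_iff, exists_eq_left, true_iff] at h
  exact h

theorem recog_compl_self (A : Language Ω) : Aᶜ ∈ Recog A Ω := by
  have h := (copier Ω).transduces_mem_recog {false} A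
  simp only [copier_transduces, Set.mem_singleton_iff, exists_eq_left, Bool.false_eq_true,
    false_iff] at h
  exact h

end Closure

section Check

variable {α Q S Ω : Type}

/-- The computations of a real-time pushdown device given by its steps; in
`step q a s (p, u)`, the topmost stack symbol `s` (`none` on the empty stack) is replaced
by `u`. -/
inductive Exec (step : Q → α → Option S → Q × List S → Prop) :
    Q × List S → List α → Q × List S → Prop
  | nil (c) : Exec step c [] c
  | cons {q v a p u T c} (h : step q a v.head? (p, u)) (h' : Exec step (p, u ++ v.tail) T c) :
      Exec step (q, v) (a :: T) c

theorem Exec.append {step : Q → α → Option S → Q × List S → Prop} {c d e : Q × List S}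
    {T T' : List α} (h : Exec step c T d) (h' : Exec step d T' e) : Exec step c (T ++ T') e := by
  induction h with
  | nil => exact h'
  | cons h _ ih => exact .cons h (ih h')

theorem exec_append_singleton {step : Q → α → Option S → Q × List S → Prop} {c d : Q × List S}
    {T : List α} {a : α} : Exec step c (T ++ [a]) d ↔
      ∃ q v p u, Exec step c T (q, v) ∧ step q a v.head? (p, u) ∧ d = (p, u ++ v.tail) := by
  constructor
  · intro h
    induction T generalizing c with
    | nil =>
      cases h with
      | cons h h' =>
        cases h'
        exact ⟨_, _, _, _, .nil _, h, rfl⟩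
    | cons b T ih =>
      cases h with
      | cons h h' =>
        obtain ⟨q, v, p, u, h₁, h₂, h₃⟩ := ih h'
        exact ⟨q, v, p, u, .cons h h₁, h₂, h₃⟩
  · rintro ⟨q, v, p, u, h₁, h₂, rfl⟩
    exact h₁.append (.cons h₂ (.nil _))

/-- The transitions of the device that remembers in the state `none` that the device given by
`step` is stuck. -/
inductive GuardedStep (step : Q → α → Option S → Q × List S → Prop) :
    Option Q → Option α → Option S → Option Q × List S × Option Ω → Prop
  | step {q a s p u} (h : step q a s (p, u)) :
      GuardedStep step (some q) (some a) s (some p, u, none)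
  | stuck {q a s} (h : ∀ q' r, q = some q' → ¬ step q' a s r) :
      GuardedStep step q (some a) s (none, [], none)

variable {step : Q → α → Option S → Q × List S → Prop}

theorem GuardedStep.unique (h_det : ∀ q a s r r', step q a s r → step q a s r' → r = r')
    {q : Option Q} {a : Option α} {s : Option S} {r r' : Option Q × List S × Option Ω}
    (h : GuardedStep step q a s r) (h' : GuardedStep step q a s r') : r = r' := by
  cases h with
  | step h =>
    cases h' with
    | step h' => cases h_det _ _ _ _ _ h h'; rfl
    | stuck h' => exact absurd h (h' _ _ rfl)
  | stuck h =>
    cases h' with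
    | step h' => exact absurd h' (h _ _ rfl)
    | stuck => rfl

/-- The transducer that detects that the deterministic device given by `step` does not end in a
state of `final`; it has no output. -/
abbrev rejecter (Ω : Type) [Finite Q] [Finite S] (step : Q → α → Option S → Q × List S → Prop)
    (h_det : ∀ q a s r r', step q a s r → step q a s r' → r = r') (q₀ : Q) (final : Set Q) :
    PushdownTransducer α Ω where
  State := Option Q
  Stack := S
  finite_state := inferInstance
  finite_stack := inferInstance
  δ q a s := {r | GuardedStep step q a s r}
  finite_δ _ _ _ := Set.Subsingleton.finite fun _ h _ h' => GuardedStep.unique h_det h h'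
  start := some q₀
  final q _ := ∀ q', q = some q' → q' ∉ final
  rank _ := 0
  rank_lt h := nomatch h

variable [Finite Q] [Finite S] {h_det : ∀ q a s r r', step q a s r → step q a s r' → r = r'}
  {q₀ : Q} {final : Set Q}

theorem exec_iff_of_rejecter_reach {w : List α} {q v} {y : List Ω}
    (h : (rejecter Ω step h_det q₀ final).Reach w q v y) (c : Q × List S) :
    Exec step (q₀, []) w c ↔ q = some c.1 ∧ v = c.2 := by
  induction h generalizing c with
  | init =>
    constructor
    · rintro ⟨⟩
      exact ⟨rfl, rfl⟩
    · rintro ⟨hq, hv⟩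
      obtain rfl : c = (q₀, []) := Prod.ext (Option.some.inj hq).symm hv.symm
      exact .nil _
  | @move w q v y a p u b _ h ih =>
    cases h with
    | @step q a _ p u h =>
      refine exec_append_singleton.trans ⟨?_, ?_⟩
      · rintro ⟨q, v, p, u, h_exec, h', rfl⟩
        obtain ⟨⟨⟩, rfl⟩ := (ih _).1 h_exec
        cases h_det _ _ _ _ _ h h'
        exact ⟨rfl, rfl⟩
      · obtain ⟨p', v'⟩ := c
        rintro ⟨⟨⟩, rfl⟩
        exact ⟨_, _, _, _, (ih (q, v)).2 ⟨rfl, rfl⟩, h, rfl⟩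
    | stuck h =>
      refine iff_of_false (fun hc => ?_) nofun
      obtain ⟨q, v, p, u, h_exec, h', rfl⟩ := exec_append_singleton.1 hc
      obtain ⟨hq, rfl⟩ := (ih (q, v)).1 h_exec
      exact h _ _ hq h'

theorem exists_rejecter_reach (w : List α) :
    ∃ q v, (rejecter Ω step h_det q₀ final).Reach w q v [] := by
  induction w using List.reverseRecOn with
  | nil => exact ⟨_, _, .init⟩
  | append_singleton w a ih =>
    obtain ⟨q, v, h⟩ := ih
    by_cases hq : ∃ q' r, q = some q' ∧ step q' a v.head? r
    · obtain ⟨q, ⟨p, u⟩, rfl, hs⟩ := hq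
      exact ⟨_, _, h.move (s := some a) (b := none) (GuardedStep.step hs)⟩
    · exact ⟨_, _, h.move (s := some a) (b := none)
        (GuardedStep.stuck fun q' r h₁ h₂ => hq ⟨q', r, h₁, h₂⟩)⟩

theorem recog_not_exec [Finite Ω] [Finite α] (A : Language Ω)
    (step : Q → α → Option S → Q × List S → Prop)
    (h_det : ∀ q a s r r', step q a s r → step q a s r' → r = r') (q₀ : Q) (final : Set Q) :
    {w | ¬ ∃ q v, Exec step (q₀, []) w (q, v) ∧ q ∈ final} ∈ Recog A α := by
  convert (rejecter Ω step h_det q₀ final).exists_transduces_mem_recog A using 1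
  ext w
  constructor
  · intro hw
    obtain ⟨q, v, h⟩ := exists_rejecter_reach (Ω := Ω) (h_det := h_det) (q₀ := q₀)
      (final := final) w
    refine ⟨[], q, v, h, ?_⟩
    rintro q' rfl hq'
    exact hw ⟨q', v, (exec_iff_of_rejecter_reach h _).2 ⟨rfl, rfl⟩, hq'⟩
  · rintro ⟨y, q, v, h, hf⟩ ⟨q', v', h_exec, hq'⟩
    exact hf q' ((exec_iff_of_rejecter_reach h _).1 h_exec).1 hq'

end Check

theorem head?_toList_append_tail {S : Type} (v : List S) : v.head?.toList ++ v.tail = v := by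
  cases v <;> rfl

namespace Comparator

variable {X Ω : Type}

/-- The word formed by the letters on track `s`. -/
def onTrack (s : Bool) (w : List (Bool × X)) : List X :=
  w.filterMap fun p => if p.1 = s then some p.2 else none

theorem length_onTrack_append_singleton (s : Bool) (w : List (Bool × X)) (x : Bool × X) :
    (onTrack s (w ++ [x])).length = (onTrack s w).length + if s = x.1 then 1 else 0 := by
  by_cases h : x.1 = s
  · simp [onTrack, h]
  · simp [onTrack, h, Ne.symm h]

theorem getElem?_onTrack_append_singleton (s : Bool) (w : List (Bool × X)) (x : Bool × X) (i : ℕ) :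
    (onTrack s (w ++ [x]))[i]? =
      if s = x.1 ∧ i = (onTrack s w).length then some x.2 else (onTrack s w)[i]? := by
  by_cases h : x.1 = s
  · simp only [onTrack, List.filterMap_append, List.filterMap_cons, h, List.filterMap_nil]
    grind
  · simp [onTrack, h, Ne.symm h]

/-- The stack that represents the difference `c false - c true` in unary. -/
def balance (c : Bool → ℕ) : List Bool :=
  List.replicate (c false - c true) false ++ List.replicate (c true - c false) true

/-- What replaces the topmost symbol `t` of a balance when a letter on track `s` is counted. -/
def recount (s : Bool) (t : Option Bool) : List Bool :=
  if t = some (!s) then [] else s :: t.toList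

theorem head?_balance_eq_none {c : Bool → ℕ} : (balance c).head? = none ↔ c false = c true := by
  rw [List.head?_eq_none_iff, balance, List.append_eq_nil_iff, List.replicate_eq_nil_iff,
    List.replicate_eq_nil_iff]
  omega

theorem recount_balance (s : Bool) (c : Bool → ℕ) :
    recount s (balance c).head? ++ (balance c).tail =
      balance (Function.update c s (c s + 1)) := by
  obtain h | h := le_total (c false) (c true) <;> obtain ⟨k, hk⟩ := Nat.exists_eq_add_of_le h <;>
    cases k <;> cases s <;>
    simp [balance, recount, hk, List.replicate_succ, add_assoc, Function.update] <;>
    omega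

theorem exists_getElem?_ne {l l' : List X} (h : l ≠ l') :
    ∃ i ≤ l.length, i ≤ l'.length ∧ l[i]? ≠ l'[i]? := by
  by_contra! h_eq
  obtain h_le | h_le := le_total l.length l'.length
  · have := h_eq _ le_rfl h_le
    exact h (List.ext_getElem? fun i => by grind)
  · have := h_eq _ h_le le_rfl
    exact h (List.ext_getElem? fun i => by grind)

/-- The transitions of the device that chooses a position on each of the two tracks, remembers the
letters there, and counts the letters before them. -/
inductive Trans : (Bool → Option X) → Bool × X → Option Bool → (Bool → Option X) × List Bool → Prop
  | skip {p s b} (a t) (h : p s = some b) : Trans p (s, a) t (p, t.toList)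
  | choose {p s} (a t) (h : p s = none) :
      Trans p (s, a) t (Function.update p s (some a), t.toList)
  | count {p s} (a t) (h : p s = none) : Trans p (s, a) t (p, recount s t)

theorem finite_trans [Finite X] (p : Bool → Option X) (x : Option (Bool × X)) (t : Option Bool) :
    {r : (Bool → Option X) × List Bool × Option Ω |
      ∃ a, x = some a ∧ Trans p a t (r.1, r.2.1) ∧ r.2.2 = none}.Finite := by
  have short_pushes : {u : List Bool | u.length ≤ 2}.Finite := List.finite_length_le Bool 2
  refine (Set.finite_univ.prod (short_pushes.prod (Set.finite_singleton none))).subset ?_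
  rintro ⟨p', u, o⟩ ⟨a, -, h, rfl⟩
  refine ⟨trivial, ?_, rfl⟩
  change u.length ≤ 2
  generalize h_eq : (p', u) = r at h
  cases h <;> obtain ⟨-, rfl⟩ := Prod.mk.inj h_eq
  · cases t <;> simp
  · cases t <;> simp
  · cases t <;> simp [recount]; split <;> simp

/-- The transducer that detects that the words on the two tracks have different letters at some
position; it has no output. -/
abbrev comparator (X Ω : Type) [Finite X] : PushdownTransducer (Bool × X) Ω where
  State := Bool → Option X
  Stack := Bool
  finite_state := inferInstance
  finite_stack := inferInstance
  δ p x t := {r | ∃ a, x = some a ∧ Trans p a t (r.1, r.2.1) ∧ r.2.2 = none}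
  finite_δ := finite_trans
  start _ := none
  final p t := t = none ∧ p false ≠ p true
  rank _ := 0
  rank_lt := by
    rintro q t r ⟨a, ha, -⟩
    cases ha

variable [Finite X]

theorem exists_positions_of_reach {w : List (Bool × X)} {p v} {y : List Ω}
    (h : (comparator X Ω).Reach w p v y) :
    ∃ c, v = balance c ∧ y = [] ∧ ∀ s, c s ≤ (onTrack s w).length ∧ p s = (onTrack s w)[c s]? := by
  induction h with
  | init => exact ⟨fun _ => 0, by simp [balance], rfl, fun s => ⟨Nat.zero_le _, rfl⟩⟩
  | @move w p v y x p' u o _ h ih =>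
    obtain ⟨c, rfl, rfl, hc⟩ := ih
    obtain ⟨a, rfl, h, rfl⟩ := h
    cases h with
    | @skip s b a _ h =>
      refine ⟨c, head?_toList_append_tail _, by simp, fun s' => ?_⟩
      simp only [Option.toList_some, length_onTrack_append_singleton,
        getElem?_onTrack_append_singleton]
      grind
    | @choose s a _ h =>
      refine ⟨c, head?_toList_append_tail _, by simp, fun s' => ?_⟩
      simp only [Option.toList_some, length_onTrack_append_singleton,
        getElem?_onTrack_append_singleton]
      grind
    | @count s a _ h =>
      refine ⟨_, recount_balance s c, by simp, fun s' => ?_⟩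
      simp only [Option.toList_some, length_onTrack_append_singleton,
        getElem?_onTrack_append_singleton]
      grind

theorem reach_append_singleton {w : List (Bool × X)} {x : Bool × X} {p p' v u v'}
    (h : (comparator X Ω).Reach w p v []) (h_trans : Trans p x v.head? (p', u))
    (hv : u ++ v.tail = v') : (comparator X Ω).Reach (w ++ [x]) p' v' [] :=
  hv ▸ h.move (s := some x) (b := none) ⟨x, rfl, h_trans, rfl⟩

theorem reach_of_positions {w : List (Bool × X)} {c : Bool → ℕ}
    (hc : ∀ s, c s ≤ (onTrack s w).length) :
    (comparator X Ω).Reach w (fun s => (onTrack s w)[c s]?) (balance c) [] := by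
  induction w using List.reverseRecOn generalizing c with
  | nil =>
    obtain rfl : c = fun _ => 0 := funext fun s => Nat.le_zero.1 (hc s)
    exact .init
  | append_singleton w x ih =>
    obtain ⟨s, a⟩ := x
    simp only [length_onTrack_append_singleton] at hc
    have h_state (s') := getElem?_onTrack_append_singleton s' w (s, a) (c s')
    obtain h | h | h : c s < (onTrack s w).length ∨ c s = (onTrack s w).length ∨
        c s = (onTrack s w).length + 1 := by grind
    · convert reach_append_singleton (ih (c := c) (by grind))
        (.skip a _ (List.getElem?_eq_getElem h)) (head?_toList_append_tail _) using 2 with s'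
      grind
    · convert reach_append_singleton (ih (c := c) (by grind))
        (.choose a _ (List.getElem?_eq_none h.ge)) (head?_toList_append_tail _) using 2 with s'
      grind
    · obtain ⟨n, hn⟩ : ∃ n, n + 1 = c s := ⟨_, h.symm⟩
      have hc' (s') : Function.update c s n s' ≤ (onTrack s' w).length := by grind
      convert reach_append_singleton (ih hc')
        (.count a _ (List.getElem?_eq_none (by simp; omega))) (recount_balance s _) using 2 with s'
      · grind
      · simp [hn]

theorem exists_transduces_iff {w : List (Bool × X)} :
    (∃ y, (comparator X Ω).Transduces w y) ↔ onTrack false w ≠ onTrack true w := by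
  constructor
  · rintro ⟨y, p, v, h, h_empty, h_ne⟩
    obtain ⟨c, rfl, rfl, hc⟩ := exists_positions_of_reach h
    rw [(hc _).2, (hc _).2, head?_balance_eq_none.1 h_empty] at h_ne
    exact fun h_eq => h_ne (by rw [h_eq])
  · intro h
    obtain ⟨i, hi, hi', h⟩ := exists_getElem?_ne h
    exact ⟨_, _, _, reach_of_positions (c := fun _ => i) (Bool.forall_bool.2 ⟨hi, hi'⟩),
      head?_balance_eq_none.2 rfl, h⟩

end Comparator

open Comparator in
theorem recog_filterMap_ne {β X Ω : Type} [Finite X] [Finite Ω] (A : Language Ω)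
    (f g : β → Option X) (h : ∀ b, f b = none ∨ g b = none) :
    {w | w.filterMap f ≠ w.filterMap g} ∈ Recog A β := by
  let k (b : β) : Option (Bool × X) := ((f b).map (false, ·)).or ((g b).map (true, ·))
  have hf (w : List β) : onTrack false (w.filterMap k) = w.filterMap f := by
    rw [onTrack, List.filterMap_filterMap]
    congr! with b
    have := h b
    cases hb : f b <;> cases hb' : g b <;> simp_all [k]
  have hg (w : List β) : onTrack true (w.filterMap k) = w.filterMap g := by
    rw [onTrack, List.filterMap_filterMap]
    congr! with b
    have := h b
    cases hb : f b <;> cases hb' : g b <;> simp_all [k]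
  convert recog_comap ((comparator X Ω).exists_transduces_mem_recog A) k using 1
  ext w
  rw [Set.mem_ofPred_eq, ← hf, ← hg]
  exact exists_transduces_iff.symm

section Phases

variable {α : Type}

namespace Phase

/-- The part of the input tape that is unread in a given phase, `x` being the part of the input
that is unread (and thus empty in the phase `post`). -/
def tape : Phase → List α → List (TapeSym α)
  | .pre, x => inputTape x
  | .mid, x => x.map .letter ++ [.right]
  | .post, _ => []

/-- Changes of the phase when a tape symbol (or none) is read. -/
inductive Step : Phase → Option (TapeSym α) → Phase → Prop
  | silent (ph) : Step ph none ph
  | left : Step .pre (some .left) .mid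
  | letter (a) : Step .mid (some (.letter a)) .mid
  | right : Step .mid (some .right) .post

end Phase

/-- The letter on a tape cell, if any. -/
def letterOf : Option (TapeSym α) → Option α
  | some (.letter a) => some a
  | _ => none

namespace Phase

variable {ph ph' ph'' : Phase} {s : Option (TapeSym α)} {x : List α}

theorem Step.unique (h : Step ph s ph') (h' : Step ph s ph'') : ph' = ph'' := by
  cases h <;> cases h' <;> rfl

theorem Step.tape_append (h : Step ph s ph') (hx : ph' = .post → x = []) :
    ph.tape ((letterOf s).toList ++ x) = s.toList ++ ph'.tape x := by
  cases h with
  | right => cases hx rfl; rfl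
  | _ => rfl

theorem Step.eq_nil_of_post (h : Step ph s ph') (hx : ph' = .post → x = []) (h_post : ph = .post) :
    (letterOf s).toList ++ x = [] := by
  cases h with
  | silent => exact hx h_post
  | _ => cases h_post

theorem exists_step {w : List (TapeSym α)} (h : ph.tape x = s.toList ++ w)
    (hx : ph = .post → x = []) : ∃ ph' x', Step ph s ph' ∧ x = (letterOf s).toList ++ x' ∧
      w = ph'.tape x' ∧ (ph' = .post → x' = []) := by
  obtain _ | s := s
  · exact ⟨ph, x, .silent ph, rfl, h.symm, hx⟩
  rcases ph with _ | _ | _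
  · obtain ⟨rfl, rfl⟩ := List.cons.inj h
    exact ⟨.mid, x, .left, rfl, rfl, nofun⟩
  · rcases x with _ | ⟨a, x⟩ <;> obtain ⟨rfl, rfl⟩ := List.cons.inj h
    · exact ⟨.post, [], .right, rfl, rfl, fun _ => rfl⟩
    · exact ⟨.mid, x, .letter a, rfl, rfl, nofun⟩
  · cases h

end Phase

/-- A list of words as one word, each of them being followed by `none`. -/
def encWords (xs : List (List α)) : List (Option α) :=
  xs.flatMap fun x => x.map some ++ [none]

theorem encWords_cons (x : List α) (xs : List (List α)) :
    encWords (x :: xs) = x.map some ++ none :: encWords xs := by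
  simp [encWords]

theorem encWords_append (xs xs' : List (List α)) :
    encWords (xs ++ xs') = encWords xs ++ encWords xs' :=
  List.flatMap_append ..

theorem map_some_append_none_inj {x y : List α} {u v : List (Option α)}
    (h : x.map some ++ none :: u = y.map some ++ none :: v) : x = y ∧ u = v := by
  induction x generalizing y with
  | nil => cases y <;> simp_all
  | cons a x ih => cases y <;> grind

theorem encWords_injective : Function.Injective (encWords (α := α)) := by
  intro xs ys h
  induction xs generalizing ys with
  | nil => cases ys <;> simp_all [encWords]
  | cons x xs ih =>
    cases ys with
    | nil => simp [encWords] at h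
    | cons y ys =>
      rw [encWords_cons, encWords_cons] at h
      obtain ⟨rfl, h_tail⟩ := map_some_append_none_inj h
      rw [ih h_tail]

end Phases

section Extract

variable {α β : Type} {f : β → Option (Option α)} {b : β}

theorem extract_cons_stop (v : List β) (h : f b = some none) : extract f (b :: v) = [] := by
  simp [extract, h]

theorem extract_cons_map {o : Option α} (v : List β) (h : f b = o.map some) :
    extract f (b :: v) = o.toList ++ extract f v := by
  cases o <;> simp [extract, h]

end Extract

namespace OracleNPDA

variable {α Ω Γ : Type}

/-- The moves of a machine, other than answers of the oracle. -/
structure Move (M : OracleNPDA α Ω Γ) where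
  src : M.State
  sym : Option (TapeSym α)
  top : M.Stack
  dst : M.State
  push : List M.Stack
  qry : Option Ω
  out : Option Γ
  mem : (dst, push, qry, out) ∈ M.δ src sym top

/-- Entries of transcripts of computations. A label `some b` announces that the query that is
going to be written on the query tape will be answered by `b`, and the label `none` that it will
not be submitted; so a device that reads the transcript can compute the answer in the course of
reading the query. After acceptance, `drain` reads the rest of the input. -/
inductive Entry (M : OracleNPDA α Ω Γ) : Type
  | start (l : Option Bool)
  | move (m : M.Move) (l : Option Bool)
  | answer (b : Bool) (l : Option Bool)
  | drain (s : TapeSym α)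
  | finish

instance [Finite α] (M : OracleNPDA α Ω Γ) : Finite M.Move := by
  have := M.finite_state
  have := M.finite_stack
  let transitions := ⋃ i : M.State × Option (TapeSym α) × M.Stack,
    (fun r => (i, r)) '' M.δ i.1 i.2.1 i.2.2
  have : Finite transitions := Set.Finite.to_subtype <|
    Set.finite_iUnion fun i => (M.finite_δ _ _ _).image _
  let transition (m : M.Move) : transitions :=
    ⟨((m.src, m.sym, m.top), (m.dst, m.push, m.qry, m.out)), Set.mem_iUnion.2 ⟨_, _, m.mem, rfl⟩⟩
  refine Finite.of_injective transition ?_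
  rintro ⟨⟩ ⟨⟩ h
  simp_all [transition]

instance [Finite α] (M : OracleNPDA α Ω Γ) : Finite M.Entry := by
  let code : M.Entry → Option Bool ⊕ (M.Move × Option Bool) ⊕ (Bool × Option Bool) ⊕
      Option (TapeSym α)
    | .start l => .inl l
    | .move m l => .inr (.inl (m, l))
    | .answer b l => .inr (.inr (.inl (b, l)))
    | .drain s => .inr (.inr (.inr (some s)))
    | .finish => .inr (.inr (.inr none))
  refine Finite.of_injective code ?_
  rintro (_ | _ | _ | _ | _) (_ | _ | _ | _ | _) h <;> simp_all [code]

namespace Entry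

variable {M : OracleNPDA α Ω Γ}

/-- The letter read by an entry, `none` being the end of a computation. -/
def read : M.Entry → Option (Option α)
  | .move m _ => (letterOf m.sym).map some
  | .drain s => (letterOf (some s)).map some
  | .finish => some none
  | _ => none

/-- The symbol written on the output tape by an entry. -/
def written : M.Entry → Option Γ
  | .move m _ => m.out
  | _ => none

/-- The symbol of a query that an entry appends, `none` being the end of the query. -/
def asked : M.Entry → Option (Option Ω)
  | .move m _ => m.qry.map some
  | .answer _ _ => some none
  | .finish => some none
  | _ => none

/-- As `Entry.asked`, for the queries that are answered negatively. -/
def denied : M.Entry → Option (Option Ω)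
  | .move m (some false) => m.qry.map some
  | .answer false _ => some none
  | _ => none

/-- The label of an entry at which a new query starts. -/
def label : M.Entry → Option Bool
  | .start l => l
  | .answer _ l => l
  | _ => none

end Entry

/-- `M.Transcript q ph l v y x z ys T`: the entries `T` describe a computation of `M` that starts
in the state `q` in the phase `ph` with the label `l`, the stack `v` and the query tape `y`, and
that ends in an accepting state. It reads `x`, writes `z`, and gets the answers `ys`, which need
not be correct, to its queries. -/
inductive Transcript (M : OracleNPDA α Ω Γ) : M.State → Phase → Option Bool → List M.Stack →
    List Ω → List α → List Γ → List (Bool × List Ω) → List M.Entry → Prop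
  | finish {q v y} (h : q ∈ M.acc) : Transcript M q .post none v y [] [] [] [.finish]
  | drain {q ph ph' s l v y x z ys T} (h : q ∈ M.acc) (hp : Phase.Step ph (some s) ph')
      (hT : Transcript M q ph' l v y x z ys T) :
      Transcript M q ph l v y ((letterOf (some s)).toList ++ x) z ys (.drain s :: T)
  | move {ph ph' l v y x z ys T} (m : M.Move) (h_halt : m.src ∉ M.halt) (h_query : m.src ≠ M.query)
      (hp : Phase.Step ph m.sym ph')
      (hT : Transcript M m.dst ph' l (m.push ++ v) (y ++ m.qry.toList) x z ys T) :
      Transcript M m.src ph l (m.top :: v) y ((letterOf m.sym).toList ++ x) (m.out.toList ++ z) ys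
        (.move m l :: T)
  | answer {b ph l v y x z ys T} (hT : Transcript M (M.reply b) ph l v [] x z ys T) :
      Transcript M M.query ph (some b) v y x z ((b, y) :: ys) (.answer b l :: T)

/-- `M.Transcripts xs zs ys T`: the entries `T` describe accepting computations of `M` on the
inputs `xs` with the outputs `zs` and with the answers `ys` to the queries. -/
inductive Transcripts (M : OracleNPDA α Ω Γ) :
    List (List α) → List (List Γ) → List (Bool × List Ω) → List M.Entry → Prop
  | nil : Transcripts M [] [] [] []
  | cons {l x z ys T xs zs ys' T'} (h : M.Transcript M.start .pre l [M.bottom] [] x z ys T)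
      (h' : Transcripts M xs zs ys' T') :
      Transcripts M (x :: xs) (z :: zs) (ys ++ ys') (.start l :: T ++ T')

/-- The answers `ys` are those of the oracle `A`. -/
def Correct (A : Language Ω) (ys : List (Bool × List Ω)) : Prop :=
  ∀ p ∈ ys, p.1 = true ↔ p.2 ∈ A

/-- Some entry of `T` has the label `b`, and the query that follows it is `s`. -/
def Announces {M : OracleNPDA α Ω Γ} (T : List M.Entry) (b : Bool) (s : List Ω) : Prop :=
  ∃ u θ v, T = u ++ θ :: v ∧ θ.label = some b ∧ extract Entry.asked v = s

/-- The queries that are answered negatively. -/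
def negatives (ys : List (Bool × List Ω)) : List (List Ω) :=
  ys.filterMap fun p => if p.1 then none else some p.2

section Projections

variable {M : OracleNPDA α Ω Γ} {q : M.State} {ph : Phase} {l : Option Bool} {v : List M.Stack}
  {y : List Ω} {x : List α} {z : List Γ} {ys : List (Bool × List Ω)} {T T' : List M.Entry}
  {xs : List (List α)} {zs : List (List Γ)} {b : Bool} {s : List Ω}

theorem Transcript.filterMap_read (h : M.Transcript q ph l v y x z ys T) :
    T.filterMap Entry.read = x.map some ++ [none] := by
  induction h with
  | finish => rfl
  | @drain _ _ _ s _ _ _ _ _ _ _ _ _ _ ih =>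
    cases s <;> simpa [List.filterMap_cons, Entry.read, letterOf] using ih
  | move m _ _ _ _ ih =>
    rw [List.filterMap_cons, ih, Entry.read]
    cases letterOf m.sym <;> rfl
  | answer _ ih => exact ih

theorem Transcripts.filterMap_read (h : M.Transcripts xs zs ys T) :
    T.filterMap Entry.read = encWords xs := by
  induction h with
  | nil => rfl
  | cons h _ ih => simp [List.filterMap_cons, encWords_cons, Entry.read, h.filterMap_read, ih]

theorem Transcript.filterMap_written (h : M.Transcript q ph l v y x z ys T) :
    T.filterMap Entry.written = z := by
  induction h with
  | finish => rfl
  | drain _ _ _ ih => exact ih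
  | move m _ _ _ _ ih =>
    rw [List.filterMap_cons, ih, Entry.written]
    cases m.out <;> rfl
  | answer _ ih => exact ih

theorem Transcripts.filterMap_written (h : M.Transcripts xs zs ys T) :
    T.filterMap Entry.written = zs.flatten := by
  induction h with
  | nil => rfl
  | cons h _ ih => simp [List.filterMap_cons, Entry.written, h.filterMap_written, ih]

theorem Transcript.filterMap_denied (h : M.Transcript q ph l v y x z ys T) :
    (if l = some false then y.map some else []) ++ T.filterMap Entry.denied =
      encWords (negatives ys) := by
  induction h with
  | finish => rfl
  | drain _ _ _ ih => exact ih
  | @move _ _ l _ _ _ _ _ _ m _ _ _ _ ih =>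
    rw [← ih]
    obtain _ | _ | _ := l <;> cases h : m.qry <;> simp [List.filterMap_cons, Entry.denied, h]
  | @answer b _ _ _ _ _ _ _ _ _ ih =>
    cases b <;> simp_all [List.filterMap_cons, Entry.denied, negatives, encWords_cons]

theorem Transcripts.filterMap_denied (h : M.Transcripts xs zs ys T) :
    T.filterMap Entry.denied = encWords (negatives ys) := by
  induction h with
  | nil => rfl
  | cons h _ ih =>
    have := h.filterMap_denied
    simp_all [List.filterMap_cons, Entry.denied, negatives, encWords_append]

theorem announces_cons {θ : M.Entry} : Announces (θ :: T) b s ↔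
    (θ.label = some b ∧ extract Entry.asked T = s) ∨ Announces T b s := by
  constructor
  · rintro ⟨u, θ', v, h, hθ, hs⟩
    obtain ⟨rfl, h⟩ | ⟨u, rfl, rfl⟩ := List.cons_eq_append_iff.1 h
    · cases h
      exact .inl ⟨hθ, hs⟩
    · exact .inr ⟨u, θ', v, rfl, hθ, hs⟩
  · rintro (⟨hθ, hs⟩ | ⟨u, θ', v, rfl, hθ, hs⟩)
    exacts [⟨[], θ, T, rfl, hθ, hs⟩, ⟨θ :: u, θ', v, rfl, hθ, hs⟩]

theorem Transcript.announces_append_iff (h : M.Transcript q ph l v y x z ys T)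
    (T' : List M.Entry) :
    (l = some b ∧ y ++ extract Entry.asked (T ++ T') = s) ∨ Announces (T ++ T') b s ↔
      (b, s) ∈ ys ∨ Announces T' b s := by
  induction h with
  | finish => simp [announces_cons, Entry.label]
  | @drain _ _ _ a _ _ _ _ _ _ _ _ _ _ ih =>
    rw [← ih, List.cons_append, announces_cons,
      extract_cons_map (f := Entry.asked) (b := .drain a) (o := none) _ rfl]
    simp [Entry.label]
  | move m _ _ _ _ ih =>
    rw [← ih, List.cons_append, announces_cons, List.append_assoc,
      extract_cons_map (f := Entry.asked) (b := .move m _) _ rfl]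
    simp [Entry.label]
  | answer _ ih =>
    rw [List.mem_cons, or_assoc, ← ih, List.cons_append, announces_cons,
      extract_cons_stop (f := Entry.asked) _ rfl]
    simp [Entry.label, eq_comm]

theorem Transcripts.announces_iff (h : M.Transcripts xs zs ys T) :
    Announces T b s ↔ (b, s) ∈ ys := by
  induction h with
  | nil => simp [Announces]
  | @cons l _ _ _ _ _ _ _ T' h _ ih =>
    rw [List.mem_append, ← ih, ← h.announces_append_iff, List.cons_append, announces_cons]
    rfl

end Projections

variable {M : OracleNPDA α Ω Γ}

section Runs

variable {A : Language Ω} {q : M.State} {ph : Phase} {l : Option Bool} {v : List M.Stack}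
  {y : List Ω} {x : List α} {z : List Γ} {ys : List (Bool × List Ω)} {T : List M.Entry}
  {xs : List (List α)} {zs : List (List Γ)}

theorem Step.state_not_mem_halt {c d : M.Cfg} (h : M.Step A c d) : c.state ∉ M.halt := by
  cases h using Step.move_or_answer with
  | move h_halt => exact h_halt
  | answer => exact not_or.2 ⟨M.query_not_acc, M.query_not_rej⟩

theorem Run.eq_of_mem_halt {t : ℕ} {c d : M.Cfg} (h : M.Run A t c d) (hc : c.state ∈ M.halt) :
    c = d := by
  obtain ⟨-, h⟩ | ⟨_, _, -, hs, -⟩ := h.cases_head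
  exacts [h, absurd hc hs.state_not_mem_halt]

theorem Transcript.eq_nil_of_post (h : M.Transcript q ph l v y x z ys T) :
    ph = .post → x = [] := by
  induction h with
  | finish => exact fun _ => rfl
  | drain _ hp _ ih => exact hp.eq_nil_of_post ih
  | move _ _ _ hp _ ih => exact hp.eq_nil_of_post ih
  | answer _ ih => exact ih

theorem Transcript.exists_run (h : M.Transcript q ph l v y x z ys T) (hys : Correct A ys)
    (z₀ : List Γ) :
    ∃ t c, M.Run A t ⟨q, ph.tape x, v, y, z₀⟩ c ∧ c.state ∈ M.acc ∧ c.output = z₀ ++ z := by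
  induction h generalizing z₀ with
  | finish h => exact ⟨0, _, .refl _, h, (List.append_nil z₀).symm⟩
  | drain h _ _ ih =>
    obtain ⟨t, c, hr, -, h_out⟩ := ih hys z₀
    cases hr.eq_of_mem_halt (.inl h)
    exact ⟨0, _, .refl _, h, h_out⟩
  | move m h_halt h_query hp hT ih =>
    obtain ⟨t, c, hr, hc, h_out⟩ := ih hys (z₀ ++ m.out.toList)
    rw [hp.tape_append hT.eq_nil_of_post]
    exact ⟨_, c, (Run.single (.move h_halt h_query m.mem)).trans hr, hc, by simpa using h_out⟩
  | answer _ ih =>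
    obtain ⟨h_answer, hys⟩ := List.forall_mem_cons.1 hys
    obtain ⟨t, c, hr, hc, h_out⟩ := ih hys z₀
    exact ⟨_, c, (Run.single (.answer h_answer)).trans hr, hc, h_out⟩

theorem Transcripts.forall_mem_outcomes (h : M.Transcripts xs zs ys T) (hys : Correct A ys) :
    List.Forall₂ (fun x z => z ∈ M.outcomes A x) xs zs := by
  induction h with
  | nil => exact .nil
  | cons h _ ih =>
    obtain ⟨h_first, h_rest⟩ := List.forall_mem_append.1 hys
    exact .cons (h.exists_run h_first []) (ih h_rest)

theorem exists_transcript_of_mem_acc (hq : q ∈ M.acc) (v : List M.Stack) (y : List Ω)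
    (hx : ph = .post → x = []) :
    ∃ T, M.Transcript q ph none v y x [] [] T ∧ T.length ≤ x.length + 3 := by
  have drain_mid (x : List α) : ∃ T, M.Transcript q .mid none v y x [] [] T ∧
      T.length ≤ x.length + 2 := by
    induction x with
    | nil => exact ⟨_, .drain hq .right (.finish hq), le_rfl⟩
    | cons a x ih =>
      obtain ⟨T, hT, h_length⟩ := ih
      exact ⟨_, .drain hq (.letter a) hT, Nat.succ_le_succ h_length⟩
  obtain _ | _ | _ := ph
  · obtain ⟨T, hT, h_length⟩ := drain_mid x
    exact ⟨_, .drain hq .left hT, Nat.succ_le_succ h_length⟩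
  · obtain ⟨T, hT, h_length⟩ := drain_mid x
    exact ⟨T, hT, h_length.trans (Nat.le_succ _)⟩
  · cases hx rfl
    exact ⟨_, .finish hq, by simp⟩

theorem exists_transcript {t : ℕ} {c : M.Cfg} {z₀ : List Γ}
    (h : M.Run A t ⟨q, ph.tape x, v, y, z₀⟩ c) (hc : c.state ∈ M.acc) (hx : ph = .post → x = []) :
    ∃ l z ys T, M.Transcript q ph l v y x z ys T ∧ Correct A ys ∧ c.output = z₀ ++ z ∧
      T.length ≤ t + x.length + 3 := by
  induction t generalizing q ph x v y z₀ with
  | zero =>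
    obtain ⟨-, rfl⟩ | ⟨_, _, h_eq, -⟩ := h.cases_head
    · obtain ⟨T, hT, h_length⟩ := exists_transcript_of_mem_acc hc v y hx
      exact ⟨none, [], [], T, hT, nofun, (List.append_nil _).symm, by omega⟩
    · cases h_eq
  | succ t ih =>
    obtain ⟨h_eq, -⟩ | ⟨_, d, h_eq, hs, hr⟩ := h.cases_head
    · cases h_eq
    cases h_eq
    generalize h_cfg : (⟨q, ph.tape x, v, y, z₀⟩ : M.Cfg) = c₀ at hs
    cases hs using Step.move_or_answer with
    | @move q p s w a u v y z b o h_halt h_query h_mem =>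
      obtain ⟨rfl, h_tape, rfl, rfl, rfl⟩ := by simpa using h_cfg
      obtain ⟨ph', x, hp, rfl, rfl, hx⟩ := Phase.exists_step h_tape hx
      obtain ⟨l, z', ys, T, hT, hys, h_out, h_length⟩ := ih hr hx
      exact ⟨l, _, ys, _, .move ⟨q, s, a, p, u, b, o, h_mem⟩ h_halt h_query hp hT, hys,
        by rw [h_out, List.append_assoc],
        by simp only [List.length_cons, List.length_append]; omega⟩
    | answer h_answer =>
      cases h_cfg
      obtain ⟨l, z, ys, T, hT, hys, h_out, h_length⟩ := ih hr hx
      exact ⟨_, z, _, _, .answer hT, List.forall_mem_cons.2 ⟨h_answer, hys⟩, h_out,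
        by rw [List.length_cons]; omega⟩

theorem exists_transcripts (hM : M.Terminates) : ∃ C, ∀ A xs zs,
    List.Forall₂ (fun x z => z ∈ M.outcomes A x) xs zs →
      ∃ ys T, M.Transcripts xs zs ys T ∧ Correct A ys ∧ T.length ≤ C * (encWords xs).length := by
  obtain ⟨a, b, hab⟩ := hM
  refine ⟨a + b + 5, fun A xs zs h => ?_⟩
  induction h with
  | nil => exact ⟨[], [], .nil, nofun, Nat.zero_le _⟩
  | @cons x z xs zs hz _ ih =>
    obtain ⟨t, c, hr, hc, rfl⟩ := hz
    obtain ⟨l, z, ys, T, hT, hys, h_out, h_length⟩ := exists_transcript (ph := .pre) hr hc nofun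
    obtain ⟨ys', T', hT', hys', h_length'⟩ := ih
    rw [h_out]
    refine ⟨_, _, .cons hT hT', List.forall_mem_append.2 ⟨hys, hys'⟩, ?_⟩
    have := (hab _ _ _ _ hr).1
    rw [encWords_cons]
    simp only [List.length_append, List.length_map, List.length_cons] at *
    nlinarith [Nat.zero_le (b * x.length)]

end Runs

section Parsing

/-- States of the device that checks transcripts. -/
inductive CheckState (M : OracleNPDA α Ω Γ) : Type
  | idle
  | run (q : M.State) (ph : Phase) (l : Option Bool)

instance (M : OracleNPDA α Ω Γ) : Finite M.CheckState :=
  have := M.finite_state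
  Finite.of_injective (β := Option (M.State × Phase × Option Bool))
    (fun | .idle => none | .run q ph l => some (q, ph, l))
    (by rintro (_ | _) (_ | _) h <;> simp_all)

/-- Steps of the device that checks transcripts; the stack symbol `none` separates the stacks of
consecutive computations. -/
inductive CheckStep (M : OracleNPDA α Ω Γ) : M.CheckState → M.Entry → Option (Option M.Stack) →
    M.CheckState × List (Option M.Stack) → Prop
  | start (l s) :
      CheckStep M .idle (.start l) s (.run M.start .pre l, some M.bottom :: none :: s.toList)
  | move {m ph ph'} (l) (h_halt : m.src ∉ M.halt) (h_query : m.src ≠ M.query)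
      (hp : Phase.Step ph m.sym ph') :
      CheckStep M (.run m.src ph l) (.move m l) (some (some m.top))
        (.run m.dst ph' l, m.push.map some)
  | answer (b l ph s) :
      CheckStep M (.run M.query ph (some b)) (.answer b l) s (.run (M.reply b) ph l, s.toList)
  | drain {q ph ph' a} (l s) (h : q ∈ M.acc) (hp : Phase.Step ph (some a) ph') :
      CheckStep M (.run q ph l) (.drain a) s (.run q ph' l, s.toList)
  | finish {q} (s) (h : q ∈ M.acc) : CheckStep M (.run q .post none) .finish s (.idle, s.toList)

theorem CheckStep.unique (q : M.CheckState) (a : M.Entry) (s : Option (Option M.Stack))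
    (r r' : M.CheckState × List (Option M.Stack)) (h : M.CheckStep q a s r)
    (h' : M.CheckStep q a s r') : r = r' := by
  cases h with
  | start => cases h'; rfl
  | @move m ph _ l _ _ hp =>
    generalize h_state : CheckState.run m.src ph l = c at h'
    cases h' with
    | move _ _ _ hp' =>
      cases h_state
      rw [hp.unique hp']
  | answer b l ph =>
    generalize h_state : CheckState.run M.query ph (some b) = c at h'
    cases h'
    cases h_state
    rfl
  | drain _ _ _ hp => cases h' with | drain _ _ _ hp' => rw [hp.unique hp']
  | finish => cases h'; rfl

variable {q : M.State} {ph : Phase} {l : Option Bool} {v : List M.Stack}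
  {y : List Ω} {x : List α} {z : List Γ} {ys : List (Bool × List Ω)} {T : List M.Entry}
  {xs : List (List α)} {zs : List (List Γ)}

theorem Transcript.exec (h : M.Transcript q ph l v y x z ys T) (r : List (Option M.Stack)) :
    ∃ s, Exec M.CheckStep (.run q ph l, v.map some ++ none :: r) T (.idle, s) := by
  induction h with
  | finish h => exact ⟨_, .cons (.finish _ h) (.nil _)⟩
  | drain h hp _ ih =>
    obtain ⟨s, hs⟩ := ih
    exact ⟨s, .cons (.drain _ _ h hp) (by rwa [head?_toList_append_tail])⟩
  | move m h_halt h_query hp _ ih =>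
    obtain ⟨s, hs⟩ := ih
    exact ⟨s, .cons (.move _ h_halt h_query hp) (by simpa using hs)⟩
  | answer _ ih =>
    obtain ⟨s, hs⟩ := ih
    exact ⟨s, .cons (.answer _ _ _ _) (by rwa [head?_toList_append_tail])⟩

theorem Transcripts.exec (h : M.Transcripts xs zs ys T) (s : List (Option M.Stack)) :
    ∃ s', Exec M.CheckStep (.idle, s) T (.idle, s') := by
  induction h generalizing s with
  | nil => exact ⟨s, .nil _⟩
  | cons h _ ih =>
    obtain ⟨s₁, h₁⟩ := h.exec s
    obtain ⟨s₂, h₂⟩ := ih s₁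
    refine ⟨s₂, .cons (.start _ _) ?_⟩
    have := h₁.append h₂
    simpa [head?_toList_append_tail] using this

theorem exists_transcripts_of_exec {s' : List (Option M.Stack)} (T : List M.Entry) :
    (∀ s, Exec M.CheckStep (.idle, s) T (.idle, s') → ∃ xs zs ys, M.Transcripts xs zs ys T) ∧
    ∀ q ph l v r y, Exec M.CheckStep (.run q ph l, v.map some ++ none :: r) T (.idle, s') →
      ∃ x z ys U xs zs ys' T', T = U ++ T' ∧ M.Transcript q ph l v y x z ys U ∧
        M.Transcripts xs zs ys' T' := by
  induction T with
  | nil => exact ⟨fun _ _ => ⟨[], [], [], .nil⟩, nofun⟩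
  | cons θ T ih =>
    obtain ⟨ih_idle, ih_run⟩ := ih
    refine ⟨fun s h => ?_, fun q ph l v r y h => ?_⟩
    · cases h with | cons h h' => ?_
      cases h with | start l => ?_
      obtain ⟨x, z, ys, U, xs, zs, ys', T', rfl, hU, hT'⟩ :=
        ih_run _ _ _ [M.bottom] s [] (by simpa [head?_toList_append_tail] using h')
      exact ⟨_, _, _, .cons hU hT'⟩
    · cases h with | cons h h' => ?_
      generalize h_top : (v.map some ++ none :: r).head? = t at h
      cases h with
      | @move m _ ph' _ h_halt h_query hp =>
        obtain ⟨v, rfl⟩ : ∃ v', v = m.top :: v' := by cases v <;> simp_all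
        obtain ⟨x, z, ys, U, xs, zs, ys', T', rfl, hU, hT'⟩ :=
          ih_run _ _ _ (m.push ++ v) r (y ++ m.qry.toList) (by simpa using h')
        exact ⟨_, _, _, _, _, _, _, _, rfl, .move m h_halt h_query hp hU, hT'⟩
      | answer b =>
        rw [← h_top, head?_toList_append_tail] at h'
        obtain ⟨x, z, ys, U, xs, zs, ys', T', rfl, hU, hT'⟩ :=
          ih_run _ _ _ v r [] h'
        exact ⟨_, _, _, _, _, _, _, _, rfl, .answer hU, hT'⟩
      | drain _ _ h hp =>
        rw [← h_top, head?_toList_append_tail] at h'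
        obtain ⟨x, z, ys, U, xs, zs, ys', T', rfl, hU, hT'⟩ :=
          ih_run _ _ _ v r y h'
        exact ⟨_, _, _, _, _, _, _, _, rfl, .drain h hp hU, hT'⟩
      | finish _ h =>
        obtain ⟨xs, zs, ys, hT⟩ := ih_idle _ h'
        exact ⟨_, _, _, [_], xs, zs, ys, T, rfl, .finish h, hT⟩

end Parsing

section Recognition

variable {Ω' : Type} [Finite Ω']

theorem recog_not_transcripts [Finite α] (A : Language Ω') :
    {T : List M.Entry | ¬ ∃ xs zs ys, M.Transcripts xs zs ys T} ∈ Recog A M.Entry := by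
  have := M.finite_stack
  convert recog_not_exec A M.CheckStep CheckStep.unique .idle {.idle} using 1
  refine Set.ext fun T => not_congr ⟨?_, ?_⟩
  · rintro ⟨xs, zs, ys, hT⟩
    obtain ⟨s, hs⟩ := hT.exec []
    exact ⟨_, s, hs, rfl⟩
  · rintro ⟨_, s, hs, rfl⟩
    exact (exists_transcripts_of_exec T).1 [] hs

theorem recog_announces [Finite Ω] {A : Language Ω'} {L : Language Ω} (hL : L ∈ Recog A Ω)
    (b : Bool) : {T : List M.Entry | ∃ s ∈ L, Announces T b s} ∈ Recog A M.Entry := by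
  convert recog_iUnion_segment (ι := Unit) (fun _ => hL)
    (fun _ θ => ∃ θ' : M.Entry, θ = some θ' ∧ θ'.label = some b) (fun _ => Entry.asked) using 1
  ext T
  constructor
  · rintro ⟨_, hs, u, θ, v, rfl, hθ, rfl⟩
    exact ⟨(), v, .inr ⟨u, θ, rfl, θ, rfl, hθ⟩, hs⟩
  · rintro ⟨_, v, ⟨⟨_, h, -⟩, -⟩ | ⟨u, θ, rfl, _, h, hθ⟩, hs⟩
    · cases h
    · cases h
      exact ⟨_, hs, u, θ, v, rfl, hθ, rfl⟩

end Recognition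

end OracleNPDA

section Guessing

variable {α Θ : Type}

/-- Transitions of the transducer that copies its input, marks its end by `none`, and writes at
most `C` symbols of `Θ` before each letter of the input and before the mark. The state `some i`
permits `i` symbols until the next letter. -/
inductive GuessStep (α Θ : Type) (C : ℕ) : Option (Fin (C + 1)) → Option α →
    Option (Fin (C + 1)) × Option (Option α ⊕ Θ) → Prop
  | write {i j} (h : j < i) (θ) : GuessStep α Θ C (some i) none (some j, some (.inr θ))
  | finish (i) : GuessStep α Θ C (some i) none (none, some (.inl none))
  | read (i a) : GuessStep α Θ C (some i) (some a) (some (Fin.last C), some (.inl (some a)))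

/-- The transducer that intersperses its input with guessed symbols of `Θ`. -/
abbrev guesser (α Θ : Type) [Finite α] [Finite Θ] (C : ℕ) :
    PushdownTransducer α (Option α ⊕ Θ) where
  State := Option (Fin (C + 1))
  Stack := Empty
  finite_state := inferInstance
  finite_stack := inferInstance
  δ q a _ := {r | GuessStep α Θ C q a (r.1, r.2.2) ∧ r.2.1 = []}
  finite_δ q a _ := by
    have : (Set.univ ×ˢ {[]} ×ˢ Set.univ :
        Set (Option (Fin (C + 1)) × List Empty × Option (Option α ⊕ Θ))).Finite :=
      Set.finite_univ.prod ((Set.finite_singleton _).prod Set.finite_univ)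
    exact this.subset fun r hr => ⟨trivial, hr.2, trivial⟩
  start := some (Fin.last C)
  final q _ := q = none
  rank q := q.elim 0 fun i => i + 1
  rank_lt := by
    rintro q _ ⟨p, u, o⟩ ⟨h, -⟩
    cases h with
    | write h => simpa using h
    | finish => simp

theorem filterMap_getRight?_append (w : List (Option α ⊕ Θ)) (m : List Θ) (a : Option α) :
    (w ++ m.map Sum.inr ++ [Sum.inl a]).filterMap Sum.getRight? =
      w.filterMap Sum.getRight? ++ m := by
  have : Sum.getRight? ∘ (Sum.inr : Θ → Option α ⊕ Θ) = some := rfl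
  simp [List.filterMap_map, this]

variable [Finite α] [Finite Θ] {C : ℕ}

theorem filterMap_getLeft?_of_guesser_reach {x : List α} {q v} {w : List (Option α ⊕ Θ)}
    (h : (guesser α Θ C).Reach x q v w) :
    w.filterMap Sum.getLeft? = x.map some ++ if q = none then [none] else [] := by
  induction h with
  | init => simp
  | @move x q v y s p u b _ h ih =>
    obtain ⟨h, -⟩ := h
    generalize h_eq : (p, b) = r at h
    cases h <;> cases h_eq <;> simp [ih]

theorem guesser_reach_append {x : List α} {i : Fin (C + 1)} {w : List (Option α ⊕ Θ)}
    (h : (guesser α Θ C).Reach x (some i) [] w) {m : List Θ} (hm : m.length ≤ i) :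
    ∃ j : Fin (C + 1), (guesser α Θ C).Reach x (some j) [] (w ++ m.map .inr) := by
  induction m generalizing i w with
  | nil => exact ⟨i, by simpa using h⟩
  | cons θ m ih =>
    rw [List.length_cons] at hm
    let k : Fin (C + 1) := ⟨i - 1, by omega⟩
    have hk : k < i := Fin.lt_def.2 (by dsimp only [k]; omega)
    obtain ⟨j, hj⟩ := ih (i := k) (w := w ++ [.inr θ])
      (by simpa using h.move (s := none) (u := []) (b := some (.inr θ)) ⟨.write hk θ, rfl⟩)
      (by dsimp only [k]; omega)
    exact ⟨j, by simpa using hj⟩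

theorem exists_guesser_reach {x : List α} {m : List Θ} (hm : m.length ≤ C * x.length) :
    ∃ w, (guesser α Θ C).Reach x (some (Fin.last C)) [] w ∧ w.filterMap Sum.getRight? = m := by
  induction x using List.reverseRecOn generalizing m with
  | nil =>
    obtain rfl : m = [] := by simpa using hm
    exact ⟨[], .init, rfl⟩
  | append_singleton x a ih =>
    rw [List.length_append, List.length_singleton, Nat.mul_add_one] at hm
    obtain ⟨w, hw, h_eq⟩ := ih (m := m.take (C * x.length)) (by simp)
    obtain ⟨j, hj⟩ := guesser_reach_append hw (m := m.drop (C * x.length)) (by simp; omega)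
    have h_read := hj.move (s := some a) (u := []) (b := some (.inl (some a))) ⟨.read j a, rfl⟩
    refine ⟨_, h_read, ?_⟩
    rw [Option.toList_some, filterMap_getRight?_append, h_eq, List.take_append_drop]

theorem exists_guesser_transduces {x : List α} {m : List Θ} (hm : m.length ≤ C * (x.length + 1)) :
    ∃ w, (guesser α Θ C).Transduces x w ∧ w.filterMap Sum.getRight? = m := by
  rw [Nat.mul_add_one] at hm
  obtain ⟨w, hw, h_eq⟩ :=
    exists_guesser_reach (C := C) (x := x) (m := m.take (C * x.length)) (by simp)
  obtain ⟨j, hj⟩ := guesser_reach_append hw (m := m.drop (C * x.length)) (by simp; omega)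
  have h_end := hj.move (s := none) (p := none) (u := []) (b := some (.inl none)) ⟨.finish j, rfl⟩
  rw [Option.toList_none, List.append_nil] at h_end
  refine ⟨_, ⟨none, _, h_end, rfl⟩, ?_⟩
  rw [Option.toList_some, filterMap_getRight?_append, h_eq, List.take_append_drop]

theorem recog_of_certificates {L : Language α} {E : Language (Option α ⊕ Θ)} (C : ℕ)
    (sound : ∀ x, ∀ w ∈ E, w.filterMap Sum.getLeft? = x.map some ++ [none] → x ∈ L)
    (complete : ∀ x ∈ L, ∃ m : List Θ, m.length ≤ C * (x.length + 1) ∧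
      ∀ w : List (Option α ⊕ Θ), w.filterMap Sum.getLeft? = x.map some ++ [none] →
        w.filterMap Sum.getRight? = m → w ∈ E) : L ∈ Recog E α := by
  have left_eq {x : List α} {w} (h : (guesser α Θ C).Transduces x w) :
      w.filterMap Sum.getLeft? = x.map some ++ [none] := by
    obtain ⟨_, _, h, rfl⟩ := h
    exact filterMap_getLeft?_of_guesser_reach h
  suffices h_eq : L = {x | ∃ w, ∃ b ∈ ({true} : Set Bool),
      (guesser α Θ C).Transduces x w ∧ (b = true ↔ w ∈ E)} from
    h_eq ▸ (guesser α Θ C).transduces_mem_recog {true} E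
  refine Set.ext fun x => ⟨fun hx => ?_, ?_⟩
  · obtain ⟨m, hm, h⟩ := complete x hx
    obtain ⟨w, hw, h_eq⟩ := exists_guesser_transduces hm
    exact ⟨w, true, rfl, hw, iff_of_true rfl (h w (left_eq hw) h_eq)⟩
  · rintro ⟨w, _, rfl, hw, hE⟩
    exact sound x w (hE.1 rfl) (left_eq hw)

end Guessing

section Tracks

variable {α Γ : Type}

theorem track_filterMap_fst (x : List α) (y : List Γ) : (track x y).filterMap Prod.fst = x := by
  induction x generalizing y with
  | nil => simp [track, List.filterMap_map]
  | cons a x ih =>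
    cases y with
    | nil => simp [track]
    | cons b y => simpa [track] using ih y

theorem track_filterMap_snd (x : List α) (y : List Γ) : (track x y).filterMap Prod.snd = y := by
  induction x generalizing y with
  | nil => simp [track, List.filterMap_map]
  | cons a x ih =>
    cases y with
    | nil => simp [track]
    | cons b y => simpa [track] using ih y

theorem length_track_le (x : List α) (y : List Γ) : (track x y).length ≤ x.length + y.length := by
  induction x generalizing y with
  | nil => simp [track]
  | cons a x ih =>
    cases y with
    | nil => simp [track]
    | cons b y =>
      have := ih y
      simp only [track, List.zipWithAll_cons_cons, List.length_cons] at this ⊢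
      omega

/-- The words of the form `track x y`. -/
def Tracks (α Γ : Type) : Language (Option α × Option Γ) :=
  {T | ∃ x y, track x y = T}

theorem track_mem_tracks (x : List α) (y : List Γ) : track x y ∈ Tracks α Γ :=
  ⟨x, y, rfl⟩

theorem track_filterMap_of_mem {T : List (Option α × Option Γ)} (h : T ∈ Tracks α Γ) :
    track (T.filterMap Prod.fst) (T.filterMap Prod.snd) = T := by
  obtain ⟨x, y, rfl⟩ := h
  rw [track_filterMap_fst, track_filterMap_snd]

open Classical in
/-- The automaton for `Tracks α Γ`. In the state `some (f, g)`, `f` and `g` tell whether the upper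
and the lower track have ended. -/
noncomputable def tracksDFA (α Γ : Type) : DFA (Option α × Option Γ) (Option (Bool × Bool)) where
  step q a := q.bind fun (f, g) =>
    if (f = true → a.1 = none) ∧ (g = true → a.2 = none) ∧ a ≠ (none, none) then
      some (a.1.isNone, a.2.isNone)
    else none
  start := some (false, false)
  accept := {q | q ≠ none}

theorem track_eq_cons_iff {x : List α} {y : List Γ} {a : Option α × Option Γ}
    {T : List (Option α × Option Γ)} : track x y = a :: T ↔ a ≠ (none, none) ∧
      ∃ x' y', x = a.1.toList ++ x' ∧ y = a.2.toList ++ y' ∧ (a.1 = none → x' = []) ∧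
        (a.2 = none → y' = []) ∧ track x' y' = T := by
  obtain ⟨_ | a, _ | b⟩ := a <;> cases x <;> cases y <;> simp [track]; aesop

theorem evalFrom_tracksDFA_none (T : List (Option α × Option Γ)) :
    (tracksDFA α Γ).evalFrom none T = none := by
  induction T with
  | nil => rfl
  | cons _ _ ih => exact ih

theorem evalFrom_tracksDFA_ne_none_iff (f g : Bool) (T : List (Option α × Option Γ)) :
    (tracksDFA α Γ).evalFrom (some (f, g)) T ≠ none ↔
      ∃ x y, (f = true → x = []) ∧ (g = true → y = []) ∧ track x y = T := by
  induction T generalizing f g with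
  | nil => exact iff_of_true nofun ⟨[], [], fun _ => rfl, fun _ => rfl, rfl⟩
  | cons a T ih =>
    simp only [DFA.evalFrom_cons, track_eq_cons_iff]
    by_cases h : (f = true → a.1 = none) ∧ (g = true → a.2 = none) ∧ a ≠ (none, none)
    · have h_step : (tracksDFA α Γ).step (some (f, g)) a = some (a.1.isNone, a.2.isNone) := if_pos h
      rw [h_step, ih]
      constructor
      · rintro ⟨x, y, hx, hy, hT⟩
        simp only [Option.isNone_iff_eq_none] at hx hy
        exact ⟨_, _, fun hf => by simp [h.1 hf, hx (h.1 hf)],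
          fun hg => by simp [h.2.1 hg, hy (h.2.1 hg)], h.2.2, x, y, rfl, rfl, hx, hy, hT⟩
      · rintro ⟨_, _, -, -, -, x, y, rfl, rfl, hx, hy, hT⟩
        exact ⟨x, y, by simpa using hx, by simpa using hy, hT⟩
    · have h_step : (tracksDFA α Γ).step (some (f, g)) a = none := if_neg h
      rw [h_step, evalFrom_tracksDFA_none]
      refine iff_of_false (not_not_intro rfl) ?_
      rintro ⟨_, _, hf, hg, ha, x, y, rfl, rfl, -⟩
      exact h ⟨fun h => by simpa using (List.append_eq_nil_iff.1 (hf h)).1,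
        fun h => by simpa using (List.append_eq_nil_iff.1 (hg h)).1, ha⟩

theorem isRegular_tracks : (Tracks α Γ).IsRegular := by
  refine ⟨_, inferInstance, tracksDFA α Γ, Set.ext fun T => ?_⟩
  refine (evalFrom_tracksDFA_ne_none_iff false false T).trans ?_
  simp [Tracks]

end Tracks

theorem recog_compl_of_isRegular {α Ω : Type} [Finite α] [Finite Ω] (A : Language Ω)
    {L : Language α} (hL : L.IsRegular) : Lᶜ ∈ Recog A α := by
  obtain ⟨σ, _, D, rfl⟩ := hL
  have exec_iff (q : σ) (w : List α) (r) :
      Exec (fun q a (_ : Option Empty) r => r = (D.step q a, [])) (q, []) w r ↔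
        r = (D.evalFrom q w, []) := by
    induction w generalizing q with
    | nil =>
      refine ⟨fun h => by cases h; rfl, ?_⟩
      rintro rfl
      exact .nil _
    | cons a w ih =>
      rw [DFA.evalFrom_cons, ← ih]
      refine ⟨fun h => ?_, fun h => .cons rfl h⟩
      cases h with | cons h h' => cases h; exact h'
  convert recog_not_exec A (fun q a (_ : Option Empty) r => r = (D.step q a, []))
    (fun _ _ _ _ _ h h' => h.trans h'.symm) D.start D.accept using 1
  simp [exec_iff]
  rfl

namespace OracleNPDA

variable {α Ω Γ Ω' : Type}

theorem mem_negatives {ys : List (Bool × List Ω)} {s : List Ω} :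
    s ∈ negatives ys ↔ (false, s) ∈ ys := by
  simp [negatives]

theorem correct_iff {A : Language Ω} {ys : List (Bool × List Ω)} :
    Correct A ys ↔ (∀ s ∈ Aᶜ, (true, s) ∉ ys) ∧ ∀ s ∈ negatives ys, s ∈ Aᶜ := by
  simp only [mem_negatives]
  refine ⟨fun h => ⟨fun s hs hy => hs ((h _ hy).1 rfl), fun s hy hs => nomatch (h _ hy).2 hs⟩, ?_⟩
  rintro ⟨h_true, h_false⟩ ⟨_ | _, s⟩ hy
  · exact iff_of_false nofun (h_false s hy)
  · exact iff_of_true rfl (by_contra fun hs => h_true s hs hy)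

theorem Transcripts.correct_iff {M : OracleNPDA α Ω Γ} {xs zs ys} {T : List M.Entry}
    (h : M.Transcripts xs zs ys T) {A : Language Ω} :
    Correct A ys ↔ (¬ ∃ s ∈ Aᶜ, Announces T true s) ∧ ¬ ∃ s ∈ A, Announces T false s := by
  simp only [OracleNPDA.correct_iff, h.announces_iff, mem_negatives, not_exists, not_and]
  exact and_congr_right fun _ => forall_congr' fun _ => imp_not_comm

/-- `IsCertificate M M' A' B u T T' W`: the entries `T` describe a computation of `M` on the input
encoded by `u`, the entries `T'` describe computations of `M'` with the oracle `A'` on the queries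
that are answered negatively in `T`, and `W` is the two-track word in `B` of the input and the
output of `M`. -/
def IsCertificate (M : OracleNPDA α Ω Γ) (M' : OracleNPDA Ω Ω' Empty) (A' : Language Ω')
    (B : Language (Option α × Option Γ)) (u : List (Option α)) (T : List M.Entry)
    (T' : List M'.Entry) (W : List (Option α × Option Γ)) : Prop :=
  (∃ xs zs ys, M.Transcripts xs zs ys T) ∧
  (∃ xs zs ys, M'.Transcripts xs zs ys T') ∧
  W ∈ Tracks α Γ ∧
  W ∈ B ∧
  u = T.filterMap Entry.read ∧
  u.filterMap id = W.filterMap Prod.fst ∧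
  T.filterMap Entry.written = W.filterMap Prod.snd ∧
  T.filterMap Entry.denied = T'.filterMap Entry.read ∧
  (¬ ∃ s ∈ M'.accepts A', Announces T true s) ∧
  (¬ ∃ s ∈ A'ᶜ, Announces T' true s) ∧
  ¬ ∃ s ∈ A', Announces T' false s

section Soundness

variable {M : OracleNPDA α Ω Γ} {M' : OracleNPDA Ω Ω' Empty} {A : Language Ω} {A' : Language Ω'}
  {B : Language (Option α × Option Γ)} {x : List α}

theorem Transcripts.correct_of_compl_eq (hA : Aᶜ = M'.accepts A') {xs zs ys xs' zs' ys'}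
    {T : List M.Entry} {T' : List M'.Entry} (h : M.Transcripts xs zs ys T)
    (h' : M'.Transcripts xs' zs' ys' T') (hys' : Correct A' ys')
    (h_denied : T.filterMap Entry.denied = T'.filterMap Entry.read)
    (h_true : ¬ ∃ s ∈ M'.accepts A', Announces T true s) : Correct A ys := by
  rw [h.filterMap_denied, h'.filterMap_read] at h_denied
  obtain rfl := encWords_injective h_denied
  simp only [← hA, h.announces_iff, not_exists, not_and] at h_true
  refine OracleNPDA.correct_iff.2 ⟨h_true, fun s hs => ?_⟩
  obtain ⟨i, hi, rfl⟩ := List.getElem_of_mem hs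
  have h_outcomes := h'.forall_mem_outcomes hys'
  obtain ⟨t, c, hr, hc, -⟩ := h_outcomes.get hi (h_outcomes.length_eq ▸ hi)
  exact hA ▸ ⟨t, c, hr, hc⟩

theorem IsCertificate.exists_mem_outcomes (hA : Aᶜ = M'.accepts A') {T T' W}
    (h : IsCertificate M M' A' B (x.map some ++ [none]) T T' W) :
    ∃ y ∈ M.outcomes A x, track x y ∈ B := by
  obtain ⟨⟨xs, zs, ys, hT⟩, ⟨xs', zs', ys', hT'⟩, hW, hB, h_read, h_fst, h_snd, h_denied, h_true,
    h_true', h_false'⟩ := h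
  have h_correct : Correct A ys :=
    hT.correct_of_compl_eq hA hT' (hT'.correct_iff.2 ⟨h_true', h_false'⟩) h_denied h_true
  have h_xs : encWords [x] = encWords xs := by
    rw [← hT.filterMap_read, ← h_read]
    simp [encWords]
  obtain rfl := encWords_injective h_xs
  obtain ⟨z, hz, rfl⟩ : ∃ z, z ∈ M.outcomes A x ∧ zs = [z] := by
    cases hT.forall_mem_outcomes h_correct with
    | cons hz h => cases h; exact ⟨_, hz, rfl⟩
  refine ⟨z, hz, ?_⟩
  have h_upper : W.filterMap Prod.fst = x := by simp [← h_fst]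
  have h_lower : W.filterMap Prod.snd = z := by simp [← h_snd, hT.filterMap_written]
  rwa [← h_upper, ← h_lower, track_filterMap_of_mem hW]

end Soundness

section Completeness

variable {M : OracleNPDA α Ω Γ} {M' : OracleNPDA Ω Ω' Empty} {A : Language Ω} {A' : Language Ω'}
  {B : Language (Option α × Option Γ)}

theorem exists_forall₂_mem_outcomes {xs : List (List α)} (h : ∀ x ∈ xs, x ∈ M.accepts A) :
    ∃ zs, List.Forall₂ (fun x z => z ∈ M.outcomes A x) xs zs := by
  induction xs with
  | nil => exact ⟨[], .nil⟩
  | cons x xs ih =>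
    obtain ⟨⟨t, c, hr, hc⟩, h_tail⟩ := List.forall_mem_cons.1 h
    obtain ⟨zs, hzs⟩ := ih h_tail
    exact ⟨_, .cons ⟨t, c, hr, hc, rfl⟩ hzs⟩

theorem exists_isCertificate (hA : Aᶜ = M'.accepts A') (hM : M.Terminates)
    (hM' : M'.Terminates) : ∃ C, ∀ x, ∀ y ∈ M.outcomes A x, track x y ∈ B →
      ∃ T T' W, T.length + T'.length + W.length ≤ C * (x.length + 1) ∧
        IsCertificate M M' A' B (x.map some ++ [none]) T T' W := by
  obtain ⟨C, hC⟩ := exists_transcripts hM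
  obtain ⟨C', hC'⟩ := exists_transcripts hM'
  refine ⟨(C' + 2) * C + 1, fun x y hy hB => ?_⟩
  obtain ⟨ys, T, hT, hys, h_length⟩ := hC A [x] [y] (.cons hy .nil)
  obtain ⟨h_true, h_neg⟩ := OracleNPDA.correct_iff.1 hys
  rw [hA] at h_true h_neg
  obtain ⟨zs, hzs⟩ := exists_forall₂_mem_outcomes h_neg
  obtain ⟨ys', T', hT', hys', h_length'⟩ := hC' A' _ zs hzs
  obtain ⟨h_true', h_false'⟩ := hT'.correct_iff.1 hys'
  refine ⟨T, T', track x y, ?_, ⟨_, _, _, hT⟩, ⟨_, _, _, hT'⟩, track_mem_tracks x y, hB, ?_⟩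
  · have h_enc : (encWords [x]).length = x.length + 1 := by simp [encWords]
    have h_denied : (encWords (negatives ys)).length ≤ T.length :=
      hT.filterMap_denied ▸ List.length_filterMap_le ..
    have h_written : y.length ≤ T.length := by
      simpa [hT.filterMap_written] using List.length_filterMap_le Entry.written T
    rw [h_enc] at h_length
    calc T.length + T'.length + (track x y).length
        ≤ T.length + C' * T.length + (x.length + T.length) := by
          gcongr
          · exact h_length'.trans (Nat.mul_le_mul_left _ h_denied)
          · exact (length_track_le x y).trans (Nat.add_le_add_left h_written _)
      _ = (C' + 2) * T.length + x.length := by ring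
      _ ≤ (C' + 2) * (C * (x.length + 1)) + (x.length + 1) := by gcongr; omega
      _ = ((C' + 2) * C + 1) * (x.length + 1) := by ring
  · refine ⟨?_, ?_, ?_, ?_, ?_, h_true', h_false'⟩
    · simp [hT.filterMap_read, encWords]
    · simp [track_filterMap_fst]
    · simp [hT.filterMap_written, track_filterMap_snd]
    · rw [hT.filterMap_denied, hT'.filterMap_read]
    · simpa [hT.announces_iff] using h_true

end Completeness

section Certificates

variable (M : OracleNPDA α Ω Γ) (M' : OracleNPDA Ω Ω' Empty)

/-- The symbols of certificates, besides those of the input. -/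
abbrev CertSym : Type := M.Entry ⊕ M'.Entry ⊕ (Option α × Option Γ)

/-- The entry of the transcript of `M`. -/
def mainEntry (c : Option α ⊕ CertSym M M') : Option M.Entry :=
  c.getRight?.bind Sum.getLeft?

/-- The entry of the transcripts of `M'`. -/
def subEntry (c : Option α ⊕ CertSym M M') : Option M'.Entry :=
  c.getRight?.bind fun d => d.getRight?.bind Sum.getLeft?

/-- The symbol of the two-track word. -/
def trackSym (c : Option α ⊕ CertSym M M') : Option (Option α × Option Γ) :=
  c.getRight?.bind fun d => d.getRight?.bind Sum.getRight?

/-- The words in which the four parts of a certificate are interspersed. -/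
def certificates (A' : Language Ω') (B : Language (Option α × Option Γ)) :
    Language (Option α ⊕ CertSym M M') :=
  {w | IsCertificate M M' A' B (w.filterMap Sum.getLeft?) (w.filterMap (mainEntry M M'))
    (w.filterMap (subEntry M M')) (w.filterMap (trackSym M M'))}

variable {M M'} {A : Language Ω} {A' : Language Ω'} {B : Language (Option α × Option Γ)}

theorem recog_not_and {β : Type} [Finite β] [Finite Ω'] {p q : List β → Prop}
    (hp : {w | ¬ p w} ∈ Recog A' β) (hq : {w | ¬ q w} ∈ Recog A' β) :
    {w | ¬ (p w ∧ q w)} ∈ Recog A' β := by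
  simp only [not_and_or]
  exact recog_union hp hq

theorem recog_not_not {β : Type} {p : List β → Prop} (hp : {w | p w} ∈ Recog A' β) :
    {w | ¬ ¬ p w} ∈ Recog A' β := by
  simpa only [not_not] using hp

theorem compl_certificates_mem_recog [Finite α] [Finite Ω] [Finite Γ] [Finite Ω']
    (hM' : M'.Terminates) (hB : B.IsRegular) :
    (certificates M M' A' B)ᶜ ∈ Recog A' (Option α ⊕ CertSym M M') := by
  refine recog_not_and ?_ <| recog_not_and ?_ <| recog_not_and ?_ <| recog_not_and ?_ <|
    recog_not_and ?_ <| recog_not_and ?_ <| recog_not_and ?_ <| recog_not_and ?_ <|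
    recog_not_and ?_ <| recog_not_and ?_ ?_
  · exact recog_comap (recog_not_transcripts A') (mainEntry M M')
  · exact recog_comap (recog_not_transcripts A') (subEntry M M')
  · exact recog_comap (recog_compl_of_isRegular A' isRegular_tracks) (trackSym M M')
  · exact recog_comap (recog_compl_of_isRegular A' hB) (trackSym M M')
  · simp only [List.filterMap_filterMap]
    exact recog_filterMap_ne A' _ _ (by rintro (_ | _) <;> simp [mainEntry])
  · simp only [List.filterMap_filterMap]
    exact recog_filterMap_ne A' _ _ (by rintro (_ | _) <;> simp [trackSym])
  · simp only [List.filterMap_filterMap]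
    exact recog_filterMap_ne A' _ _ (by rintro (_ | _ | _ | _) <;> simp [mainEntry, trackSym])
  · simp only [List.filterMap_filterMap]
    exact recog_filterMap_ne A' _ _ (by rintro (_ | _ | _ | _) <;> simp [mainEntry, subEntry])
  · have h := recog_announces (M := M) (A := A') (L := M'.accepts A') ⟨M', hM', rfl⟩ true
    exact recog_not_not (recog_comap h (mainEntry M M'))
  · have h := recog_announces (M := M') (recog_compl_self A') true
    exact recog_not_not (recog_comap h (subEntry M M'))
  · have h := recog_announces (M := M') (recog_self A') false
    exact recog_not_not (recog_comap h (subEntry M M'))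

theorem mem_certificates_of_filterMap_eq {u : List (Option α)} {T : List M.Entry}
    {T' : List M'.Entry} {W : List (Option α × Option Γ)} (h : IsCertificate M M' A' B u T T' W)
    {w : List (Option α ⊕ CertSym M M')} (h_left : w.filterMap Sum.getLeft? = u)
    (h_right : w.filterMap Sum.getRight? =
      T.map .inl ++ (T'.map (.inr ∘ .inl) ++ W.map (.inr ∘ .inr))) :
    w ∈ certificates M M' A' B := by
  have h_main : w.filterMap (mainEntry M M') = T := by
    unfold mainEntry
    rw [← List.filterMap_filterMap, h_right]
    simp [List.filterMap_append, List.filterMap_map, Function.comp_def]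
  have h_sub : w.filterMap (subEntry M M') = T' := by
    unfold subEntry
    rw [← List.filterMap_filterMap, h_right]
    simp [List.filterMap_append, List.filterMap_map, Function.comp_def]
  have h_track : w.filterMap (trackSym M M') = W := by
    unfold trackSym
    rw [← List.filterMap_filterMap, h_right]
    simp [List.filterMap_append, List.filterMap_map, Function.comp_def]
  change IsCertificate M M' A' B _ _ _ _
  rwa [h_left, h_main, h_sub, h_track]

theorem exists_oracle_recog_track_mem [Finite α] [Finite Ω] [Finite Γ] [Finite Ω']
    (hA : Aᶜ ∈ Recog A' Ω) (hM : M.Terminates) (hB : B.IsRegular) :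
    ∃ (Θ : Type) (_ : Finite Θ) (E : Language Θ), Eᶜ ∈ Recog A' Θ ∧
      {x | ∃ y ∈ M.outcomes A x, track x y ∈ B} ∈ Recog E α := by
  obtain ⟨M', hM', hA⟩ := hA
  obtain ⟨C, hC⟩ := exists_isCertificate (B := B) hA hM hM'
  refine ⟨_, inferInstance, _, compl_certificates_mem_recog (M := M) hM' hB,
    recog_of_certificates C (fun x w hw hx => ?_) fun x hx => ?_⟩
  · change IsCertificate M M' A' B _ _ _ _ at hw
    rw [hx] at hw
    exact hw.exists_mem_outcomes hA
  · obtain ⟨y, hy, hB⟩ := hx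
    obtain ⟨T, T', W, h_length, h⟩ := hC x y hy hB
    refine ⟨_, ?_, fun w h_left => mem_certificates_of_filterMap_eq h h_left⟩
    simpa [add_assoc] using h_length

end Certificates

end OracleNPDA

section Join

variable {ι : Type} {Ω : ι → Type}

/-- The word `w` over the alphabet number `i`, preceded by the tag `i`. -/
def tagged (i : ι) (w : List (Ω i)) : List (ι ⊕ Σ i, Ω i) :=
  .inl i :: w.map fun a => .inr ⟨i, a⟩

section Grammar

/-- A symbol of the grammar number `i` as a symbol of the joined grammar. -/
def liftSymbol {N : ι → Type} (i : ι) :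
    Symbol (Ω i) (N i) → Symbol (ι ⊕ Σ i, Ω i) (Option (Σ i, N i))
  | .terminal a => .terminal (.inr ⟨i, a⟩)
  | .nonterminal n => .nonterminal (some ⟨i, n⟩)

theorem liftSymbol_injective {N : ι → Type} (i : ι) :
    Function.Injective (liftSymbol (Ω := Ω) (N := N) i) := by
  rintro (a | a) (b | b) h <;> simp_all [liftSymbol]

/-- The rules of the joined grammar. -/
inductive JoinRule (g : ∀ i, ContextFreeGrammar (Ω i)) :
    ContextFreeRule (ι ⊕ Σ i, Ω i) (Option (Σ i, (g i).NT)) → Prop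
  | start (i : ι) :
      JoinRule g ⟨none, [.terminal (.inl i), .nonterminal (some ⟨i, (g i).initial⟩)]⟩
  | lift (i : ι) (r : ContextFreeRule (Ω i) (g i).NT) (h : r ∈ (g i).rules) :
      JoinRule g ⟨some ⟨i, r.input⟩, r.output.map (liftSymbol i)⟩

variable [Finite ι]

theorem finite_joinRule (g : ∀ i, ContextFreeGrammar (Ω i)) : {r | JoinRule g r}.Finite := by
  have finite_start := Set.finite_range fun i =>
    (⟨none, [.terminal (.inl i), .nonterminal (some ⟨i, (g i).initial⟩)]⟩ :
      ContextFreeRule (ι ⊕ Σ i, Ω i) (Option (Σ i, (g i).NT)))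
  have finite_lift := Set.finite_range fun p : Σ i, (g i).rules =>
    (⟨some ⟨p.1, p.2.1.input⟩, p.2.1.output.map (liftSymbol p.1)⟩ :
      ContextFreeRule (ι ⊕ Σ i, Ω i) (Option (Σ i, (g i).NT)))
  refine (finite_start.union finite_lift).subset ?_
  rintro r (i | ⟨i, r, h⟩)
  · exact .inl ⟨i, rfl⟩
  · exact .inr ⟨⟨i, r, h⟩, rfl⟩

/-- A grammar that generates the tagged words of all the given grammars. -/
noncomputable abbrev joinGrammar (g : ∀ i, ContextFreeGrammar (Ω i)) :
    ContextFreeGrammar (ι ⊕ Σ i, Ω i) where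
  NT := Option (Σ i, (g i).NT)
  initial := none
  rules := (finite_joinRule g).toFinset

variable {g : ∀ i, ContextFreeGrammar (Ω i)} {i : ι} {u u' : List (Symbol (Ω i) (g i).NT)}
  {v : List (Symbol (ι ⊕ Σ i, Ω i) (Option (Σ i, (g i).NT)))}

theorem joinGrammar_produces_initial :
    (joinGrammar g).Produces [.nonterminal none] v ↔
      ∃ i, v = [.terminal (.inl i), .nonterminal (some ⟨i, (g i).initial⟩)] := by
  constructor
  · rintro ⟨r, hr, hv⟩
    replace hr : JoinRule g r := (finite_joinRule g).mem_toFinset.1 hr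
    obtain ⟨p, q, h_eq, rfl⟩ := hv.exists_parts
    obtain ⟨rfl, h_input, rfl⟩ : p = [] ∧ none = r.input ∧ q = [] := by
      cases p <;> simp_all
    cases hr with
    | start i => exact ⟨i, rfl⟩
    | lift => cases h_input
  · rintro ⟨i, rfl⟩
    exact ⟨_, (finite_joinRule g).mem_toFinset.2 (.start i), .head []⟩

theorem joinGrammar_produces_of_produces (h : (g i).Produces u u') :
    (joinGrammar g).Produces (.terminal (.inl i) :: u.map (liftSymbol i))
      (.terminal (.inl i) :: u'.map (liftSymbol i)) := by
  obtain ⟨r, hr, hu⟩ := h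
  obtain ⟨p, q, rfl, rfl⟩ := hu.exists_parts
  refine ⟨_, (finite_joinRule g).mem_toFinset.2 (.lift i r hr), ?_⟩
  have h_rewrites := ContextFreeRule.rewrites_of_exists_parts
    (⟨some ⟨i, r.input⟩, r.output.map (liftSymbol i)⟩ :
      ContextFreeRule (ι ⊕ Σ i, Ω i) (Option (Σ i, (g i).NT)))
    (.terminal (.inl i) :: p.map (liftSymbol i)) (q.map (liftSymbol i))
  rw [List.map_append, List.map_append]
  simpa [liftSymbol] using h_rewrites

theorem exists_produces_of_joinGrammar_produces
    (h : (joinGrammar g).Produces (.terminal (.inl i) :: u.map (liftSymbol i)) v) :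
    ∃ u', v = .terminal (.inl i) :: u'.map (liftSymbol i) ∧ (g i).Produces u u' := by
  obtain ⟨r, hr, hv⟩ := h
  replace hr : JoinRule g r := (finite_joinRule g).mem_toFinset.1 hr
  obtain ⟨_ | ⟨s, p⟩, q, h_eq, rfl⟩ := hv.exists_parts
  · simp at h_eq
  simp only [List.cons_append, List.cons.injEq] at h_eq
  obtain ⟨rfl, h_eq⟩ := h_eq
  obtain ⟨_, q', rfl, h_init, rfl⟩ := List.map_eq_append_iff.1 h_eq
  obtain ⟨p', _, rfl, rfl, h_symbol⟩ := List.map_eq_append_iff.1 h_init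
  obtain ⟨_ | n, rfl, h_lift⟩ := List.map_eq_singleton_iff.1 h_symbol
  · simp [liftSymbol] at h_lift
  cases hr with
  | start j => simp [liftSymbol] at h_lift
  | lift j r h =>
    simp only [liftSymbol, Symbol.nonterminal.injEq, Option.some.injEq, Sigma.mk.injEq] at h_lift
    obtain ⟨rfl, h_lift⟩ := h_lift
    obtain rfl := eq_of_heq h_lift
    exact ⟨p' ++ r.output ++ q', by simp, r, h, r.rewrites_of_exists_parts p' q'⟩

theorem joinGrammar_derives :
    (joinGrammar g).Derives (.terminal (.inl i) :: u.map (liftSymbol i)) v ↔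
      ∃ u', v = .terminal (.inl i) :: u'.map (liftSymbol i) ∧ (g i).Derives u u' := by
  constructor
  · intro h
    induction h with
    | refl => exact ⟨u, rfl, .refl _⟩
    | tail _ h ih =>
      obtain ⟨u', rfl, hu⟩ := ih
      obtain ⟨u'', rfl, hu'⟩ := exists_produces_of_joinGrammar_produces h
      exact ⟨u'', rfl, hu.tail hu'⟩
  · rintro ⟨u', rfl, h⟩
    induction h with
    | refl => exact .refl _
    | tail _ h ih => exact ih.tail (joinGrammar_produces_of_produces h)

theorem tagged_mem_joinGrammar_language {w : List (Ω i)} :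
    tagged i w ∈ (joinGrammar g).language ↔ w ∈ (g i).language := by
  have map_tagged : (tagged i w).map (Symbol.terminal (N := (joinGrammar g).NT)) =
      .terminal (.inl i) :: (w.map .terminal).map (liftSymbol (N := fun i => (g i).NT) i) := by
    simp [tagged, liftSymbol, Function.comp_def]
  rw [ContextFreeGrammar.mem_language_iff, ContextFreeGrammar.mem_language_iff, map_tagged]
  constructor
  · intro h
    obtain h | ⟨v, h_first, h⟩ := h.cases_head
    · simp at h
    obtain ⟨j, rfl⟩ := joinGrammar_produces_initial.1 h_first
    obtain ⟨u, hu, h⟩ :=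
      (joinGrammar_derives (g := g) (i := j) (u := [.nonterminal (g j).initial])).1 h
    rw [List.cons.injEq, Symbol.terminal.injEq, Sum.inl.injEq] at hu
    obtain ⟨rfl, hu⟩ := hu
    rwa [(liftSymbol_injective i).list_map hu]
  · intro h
    refine .head (joinGrammar_produces_initial.2 ⟨i, rfl⟩) ?_
    exact (joinGrammar_derives (g := g) (u := [.nonterminal (g i).initial])).2 ⟨_, rfl, h⟩

end Grammar

theorem recog_of_cons_map {α Ω Ω' : Type} [Finite α] [Finite Ω'] {A : Language Ω}
    {A' : Language Ω'} {L : Language α} (hL : L ∈ Recog A α) {t : Ω'} {f : Ω → Ω'}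
    (hA : ∀ w, t :: w.map f ∈ A' ↔ w ∈ A) : L ∈ Recog A' α := by
  obtain ⟨M, hM, rfl⟩ := hL
  let B : Bundle Unit (fun _ => α) (fun _ => Ω) α Ω' Empty :=
    ⟨fun _ => M, fun _ b => b = none, fun _ a => some (some a), fun _ => some t, fun _ => f,
      fun _ => none⟩
  have oracle_eq : B.oracle A' () = A := Set.ext hA
  refine ⟨_, B.machine_terminates fun _ => hM,
    Set.ext fun x => Iff.trans ?_ Bundle.mem_accepts_machine.symm⟩
  have h_feed : extract (fun a => some (some a)) x = x := by
    simpa using extract_map_some some x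
  simp only [oracle_eq, B, Bundle.Launches, reduceCtorEq, and_false, exists_false,
    or_false, true_and, exists_eq_left, h_feed]
  exact (exists_const Unit).symm

open Classical in
/-- The letters of the words over the alphabet number `i`. -/
noncomputable def untag (i : ι) (b : ι ⊕ Σ i, Ω i) : Option (Option (Ω i)) :=
  b.getRight?.bind fun a => if h : a.1 = i then some (some (h ▸ a.2)) else none

theorem extract_untag (i : ι) (w : List (Ω i)) :
    extract (untag i) (w.map fun a => (.inr ⟨i, a⟩ : ι ⊕ Σ i, Ω i)) = w := by
  induction w with
  | nil => rfl
  | cons a w ih => simpa [extract, untag] using ih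

theorem tagged_eq_append_cons_inl_iff {i j : ι} {w : List (Ω i)} {u r : List (ι ⊕ Σ i, Ω i)} :
    tagged i w = u ++ .inl j :: r ↔ u = [] ∧ i = j ∧ w.map (fun a => .inr ⟨i, a⟩) = r := by
  cases u with
  | nil => simp [tagged]
  | cons b u =>
    refine iff_of_false (fun h => ?_) nofun
    have h_mem : Sum.inl j ∈ w.map fun a => (.inr ⟨i, a⟩ : ι ⊕ Σ i, Ω i) := by
      rw [(List.cons.inj h).2]
      simp
    simp at h_mem

theorem exists_recog_tagged_mem_iff [Finite ι] [∀ i, Finite (Ω i)] {Ω' : Type} [Finite Ω']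
    {A : Language Ω'} {L : ∀ i, Language (Ω i)} (hL : ∀ i, L i ∈ Recog A (Ω i)) :
    ∃ L' ∈ Recog A (ι ⊕ Σ i, Ω i), ∀ i w, tagged i w ∈ L' ↔ w ∈ L i := by
  refine ⟨_, recog_iUnion_segment hL (fun i b => b = some (.inl i)) untag, fun i w => ?_⟩
  constructor
  · rintro ⟨j, r, ⟨h, -⟩ | ⟨u, _, hw, h⟩, hr⟩
    · cases h
    · cases h
      obtain ⟨rfl, rfl, rfl⟩ := tagged_eq_append_cons_inl_iff.1 hw
      rwa [extract_untag] at hr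
  · intro hw
    refine ⟨i, _, .inr ⟨[], _, rfl, rfl⟩, ?_⟩
    rwa [extract_untag]

theorem compl_mem_piCFL {k : ℕ} {α : Type} {L : Language α} (hL : L ∈ SigmaCFL k α) :
    Lᶜ ∈ PiCFL k α := by
  change Lᶜᶜ ∈ SigmaCFL k α
  rwa [compl_compl]

theorem exists_tagged_mem_iff_of_mem_piCFL [Finite ι] (k : ℕ) {Ω : ι → Type} [∀ i, Finite (Ω i)]
    {A : ∀ i, Language (Ω i)} (hA : ∀ i, A i ∈ PiCFL (k + 1) (Ω i)) :
    ∃ A' ∈ PiCFL (k + 1) (ι ⊕ Σ i, Ω i), ∀ i w, tagged i w ∈ A' ↔ w ∈ A i := by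
  suffices ∃ L ∈ SigmaCFL (k + 1) (ι ⊕ Σ i, Ω i), ∀ i w, tagged i w ∈ L ↔ w ∈ (A i)ᶜ by
    obtain ⟨L, hL, h⟩ := this
    exact ⟨Lᶜ, compl_mem_piCFL hL, fun i w => (not_congr (h i w)).trans not_not⟩
  induction k generalizing Ω with
  | zero =>
    choose g hg using hA
    refine ⟨_, ⟨joinGrammar g, rfl⟩, fun i w => ?_⟩
    rw [tagged_mem_joinGrammar_language, hg]
  | succ k ih =>
    choose Ω' _ A' hA' hL using hA
    obtain ⟨L, hL_sigma, h⟩ := ih hA'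
    have hA'' (i : ι) (w : List (Ω' i)) : tagged i w ∈ Lᶜ ↔ w ∈ A' i :=
      (not_congr (h i w)).trans not_not
    obtain ⟨L', hL', h⟩ := exists_recog_tagged_mem_iff fun i => recog_of_cons_map (hL i) (hA'' i)
    exact ⟨L', ⟨_, inferInstance, Lᶜ, compl_mem_piCFL hL_sigma, hL'⟩, h⟩

theorem exists_common_oracle [Finite ι] (k : ℕ) {α : ι → Type} [∀ i, Finite (α i)]
    {L : ∀ i, Language (α i)} (hL : ∀ i, L i ∈ SigmaCFL (k + 2) (α i)) :
    ∃ (Ω : Type) (_ : Finite Ω), ∃ A ∈ PiCFL (k + 1) Ω, ∀ i, L i ∈ Recog A (α i) := by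
  choose Ω _ A hA hL using hL
  obtain ⟨A', hA', h⟩ := exists_tagged_mem_iff_of_mem_piCFL k hA
  exact ⟨_, inferInstance, A', hA', fun i => recog_of_cons_map (hL i) (h i)⟩

end Join

section Decision

theorem exists_outcomes_eq_index {ι α Ω : Type} [Finite ι] [Finite α] [Finite Ω] {A : Language Ω}
    {L : ι → Language α} (hL : ∀ i, L i ∈ Recog A α) :
    ∃ M : OracleNPDA α Ω ι, M.Terminates ∧ ∀ x, M.outcomes A x = {z | ∃ i, x ∈ L i ∧ z = [i]} := by
  choose M hM hL using hL
  let B : Bundle ι (fun _ => α) (fun _ => Ω) α Ω ι :=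
    ⟨M, fun _ b => b = none, fun _ a => some (some a), fun _ => none, fun _ => id, some⟩
  have oracle_eq (i : ι) : B.oracle A i = A := B.oracle_eq_self rfl rfl A
  refine ⟨_, B.machine_terminates hM, fun x => Set.ext fun z => ?_⟩
  refine Bundle.mem_outcomes_machine.trans ?_
  have h_feed : extract (fun a => some (some a)) x = x := by
    simpa using extract_map_some some x
  simp only [oracle_eq, ← hL, B, Bundle.Launches]
  simp [h_feed]

/-- The two-track words whose lower track begins with `true`. -/
def lowerHeadTrue (α : Type) : Language (Option α × Option Bool) :=
  {w | ∃ a v, w = (a, some true) :: v}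

theorem isRegular_lowerHeadTrue (α : Type) : (lowerHeadTrue α).IsRegular := by
  classical
  let D : DFA (Option α × Option Bool) (Option Bool) :=
    ⟨fun q a => some (q.getD (decide (a.2 = some true))), none, {some true}⟩
  have evalFrom_some (b : Bool) (w : List (Option α × Option Bool)) :
      D.evalFrom (some b) w = some b := by
    induction w with
    | nil => rfl
    | cons _ _ ih => exact ih
  refine ⟨Option Bool, inferInstance, D, Set.ext fun w => ?_⟩
  change D.evalFrom none w = some true ↔ ∃ a v, w = (a, some true) :: v
  rcases w with _ | ⟨⟨a, c⟩, w⟩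
  · simp
  · rw [DFA.evalFrom_cons, evalFrom_some]
    simp

theorem track_singleton_mem_lowerHeadTrue {α : Type} {x : List α} {b : Bool} :
    track x [b] ∈ lowerHeadTrue α ↔ b = true := by
  change (∃ a v, _ = _) ↔ _
  cases x <;> simp [track, List.zipWithAll]

theorem mem_regAdvice_sigmaCFLSVt {k : ℕ} {α : Type} [Finite α] {L : Language α}
    (h : L ∈ SigmaCFL (k + 2) α) (h_compl : Lᶜ ∈ SigmaCFL (k + 2) α) :
    L ∈ RegAdvice (SigmaCFLSVt (k + 2)) α := by
  classical
  have h_cases (b : Bool) : (bif b then L else Lᶜ) ∈ SigmaCFL (k + 2) α := by cases b <;> assumption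
  obtain ⟨Ω, _, A, hA, h_recog⟩ := exists_common_oracle k h_cases
  obtain ⟨M, hM, h_out⟩ := exists_outcomes_eq_index h_recog
  have outcomes_eq (x : List α) : M.outcomes A x = {[decide (x ∈ L)]} := by
    have mem_iff (b : Bool) : x ∈ (bif b then L else Lᶜ) ↔ b = decide (x ∈ L) := by
      cases b
      · exact (decide_eq_false_iff_not.trans Iff.rfl).symm.trans eq_comm
      · exact decide_eq_true_iff.symm.trans eq_comm
    simp only [h_out, mem_iff, exists_eq_left]
    rfl
  refine ⟨Bool, inferInstance, lowerHeadTrue α, M.outcomes A, isRegular_lowerHeadTrue α,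
    ⟨⟨⟨Ω, inferInstance, A, hA, M, hM, fun _ => rfl⟩, fun x => ?_⟩, fun x => ?_⟩,
    Set.ext fun x => ?_⟩
  · rw [outcomes_eq]
    exact Set.subsingleton_singleton
  · rw [outcomes_eq]
    exact Set.singleton_nonempty _
  · change x ∈ L ↔ ∃ y ∈ M.outcomes A x, track x y ∈ lowerHeadTrue α
    simp [outcomes_eq, track_singleton_mem_lowerHeadTrue]

end Decision

section Advice

theorem setOf_track_mem_mem_sigmaCFL {k : ℕ} {α Γ : Type} [Finite α] [Finite Γ]
    {f : List α → Set (List Γ)} (hf : f ∈ SigmaCFLMV (k + 3) α Γ)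
    {B : Language (Option α × Option Γ)} (hB : B.IsRegular) :
    {x | ∃ y ∈ f x, track x y ∈ B} ∈ SigmaCFL (k + 3) α := by
  obtain ⟨Ω, _, A, ⟨Ω', _, A', hA', hA⟩, M, hM, hf⟩ := hf
  obtain ⟨Θ, _, E, hE, h⟩ := M.exists_oracle_recog_track_mem hA hM hB
  simp only [hf]
  exact ⟨Θ, inferInstance, E, ⟨Ω', inferInstance, A', hA', hE⟩, h⟩

theorem compl_setOf_track_mem {α Γ : Type} {f : List α → Set (List Γ)}
    (h_single : ∀ x, (f x).Subsingleton) (h_total : ∀ x, (f x).Nonempty)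
    (B : Language (Option α × Option Γ)) :
    ({x | ∃ y ∈ f x, track x y ∈ B} : Language α)ᶜ = {x | ∃ y ∈ f x, track x y ∈ Bᶜ} := by
  refine Set.ext fun x => ?_
  obtain ⟨y, hy⟩ := (h_single x).eq_empty_or_singleton.resolve_left (h_total x).ne_empty
  change (¬ ∃ y ∈ f x, track x y ∈ B) ↔ ∃ y ∈ f x, track x y ∉ B
  simp [hy]

end Advice

theorem mainTheorem4 (k : ℕ) (hk : 3 ≤ k) (α : Type) [Finite α] :
    SigmaCFL k α ∩ PiCFL k α = RegAdvice (SigmaCFLSVt k) α := by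
  obtain ⟨k, rfl⟩ := Nat.exists_eq_add_of_le' hk
  refine Set.Subset.antisymm (fun L ⟨h, h_compl⟩ => mem_regAdvice_sigmaCFLSVt h h_compl) ?_
  rintro _ ⟨Γ, _, B, f, hB, ⟨⟨hf, h_single⟩, h_total⟩, rfl⟩
  refine ⟨setOf_track_mem_mem_sigmaCFL hf hB, ?_⟩
  have compl_mem := setOf_track_mem_mem_sigmaCFL hf hB.compl
  rwa [← compl_setOf_track_mem h_single h_total] at compl_mem
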